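/- Let $q\ge 1$ be an integer and let $X=(VX,EX)$ be a countable simple graph that is $(q+1)$-regular. Let $\Gamma$ be a group of automorphisms of $X$ that acts freely on $X$ (no element other than the identity fixes a vertex or a geometric edge) and has finitely many orbits on $VX$. Let $B=X/\Gamma$ be the quotient graph, with vertex set $VB$ and set of geometric edges $EB$, let $\chi(B)=|VB|-|EB|$, and let $\mathcal F\subset VX$ be a set of representatives of $VX/\Gamma$. Let $A$ be the adjacency operator on $\ell^2(VX)$, $Q=\mathrm{diag}(\deg(v)-1)$, and $\Delta(u)=(1+qu^2)I-uA$ for $u\in\mathbb C$. *Trace and determinant.* Let $\mathcal N(X,\Gamma)$ be the von Neumann algebra of bounded operators on $\ell^2(VX)$ that commute with $(\lambda(\gamma)f)(x)=f(\gamma^{-1}x)$, $\gamma\in\Gamma$, with the trace $\mathrm{Tr}_\Gamma(T)=\sum_{x\in\mathcal F}T(x,x)$, and put $\chi^{(2)}(X)=-\tfrac12\mathrm{Tr}_\Gamma(Q-I)$. For $T\in\mathcal N(X,\Gamma)$ with $0\notin\mathrm{conv}\,\sigma(T)$ put $$\det\nolimits_\Gamma(T)=\exp\Bigl(\mathrm{Tr}_\Gamma\Bigl(\frac1{2\pi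 i}\int_{\partial D}\log\lambda\,(\lambda-T)^{-1}\,d\lambda\Bigr)\Bigr),$$ where $D\supset\mathrm{conv}\,\sigma(T)$ is an open disc whose closure does not contain $0$, and $\log$ is a branch of the logarithm on $\overline D$ (the value does not depend on these choices). *Zeta function.* A closed path of length $m\ge1$ is a sequence $(v_0,\dots,v_m=v_0)$ of vertices with $v_i\sim v_{i+1}$. It is reduced if it has no backtracking ($v_{i-1}\ne v_{i+1}$ for $1\le i\le m-1$) and no tail (there is no $k$ with $1\le k\le[m/2]-1$ and $v_j=v_{m-j}$ for $1\le j\le k$). It is primitive if it is not obtained by going $n\ge2$ times around another closed path. A prime cycle is a class of primitive reduced closed paths modulo cyclic shifts of the origin. For a prime cycle $C$ let $|C|$ be its length and $\Gamma_C$ its stabilizer in $\Gamma$. Define $$Z_{X,\Gamma}(u)=\prod_{[C]_\Gamma}(1-u^{|C|})^{-1/|\Gamma_C|},$$ the product running over the $\Gamma$-orbits of prime cycles, with the principal branch of the power. Let $$\Omega=\mathbb R^2\setminus\Bigl(\bigl\{(x,y):x^2+y^2=\tfrac1q\bigr\}\cup\bigl\{(x,0):\tfrac1q\le|x|\le1\bigr\}\Bigr)\subset\mathbb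 C .$$ Then $\Delta(u)\in\mathcal N(X,\Gamma)$ for all $u\in\mathbb C$, and: 1. $\chi^{(2)}(X)=\chi(B)=|VB|(1-q)/2\in\mathbb Z$. 2. For $|u|<1/q$ the product defining $Z_{X,\Gamma}(u)$ converges unconditionally and $Z_{X,\Gamma}(u)=(1-u^2)^{\chi(B)}\det_\Gamma(\Delta(u))^{-1}$. 3. The set $\Omega$ is open and contains $\{|u|<1/q\}$; for every $u\in\Omega$ we have $0\notin\mathrm{conv}\,\sigma(\Delta(u))$, so that $\det_\Gamma(\Delta(u))$ is defined; and $u\mapsto(1-u^2)^{\chi(B)}\det_\Gamma(\Delta(u))^{-1}$ is holomorphic on $\Omega$. Thus the formula in 2 extends $Z_{X,\Gamma}$ to a holomorphic function on $\Omega$. 4. For every $u\in\Omega\setminus\{0\}$ we have $\frac1{qu}\in\Omega$ and $\det_\Gamma\bigl(\Delta(\tfrac1{qu})\bigr)=(qu^2)^{-|VB|}\det_\Gamma(\Delta(u))$. -/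

import Mathlib

noncomputable section

namespace PeriodicGraph

variable {V : Type*}

/-! ### Closed paths, cycles and prime cycles -/

/-- A closed path `(v₀, …, v_m = v₀)` of length `m ≥ 1` in a simple graph. The vertices are indexed
by all natural numbers, the index being read modulo `m`; thus `vert` is determined by its first
`m + 1` values, and any closed sequence of successively adjacent vertices occurs. -/
@[ext]
structure ClosedPath (G : SimpleGraph V) where
  /-- the length `m` -/
  len : ℕ
  len_pos : 0 < len
  /-- the vertex `v_j` -/
  vert : ℕ → V
  periodic : ∀ j, vert (j + len) = vert j
  adj : ∀ j, G.Adj (vert j) (vert (j + 1))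

namespace ClosedPath

variable {G : SimpleGraph V}

/-- `v_{i-1} = v_{i+1}` for some `1 ≤ i ≤ m - 1`. -/
def HasBacktracking (C : ClosedPath G) : Prop :=
  ∃ i, 1 ≤ i ∧ i + 1 ≤ C.len ∧ C.vert (i - 1) = C.vert (i + 1)

/-- `v_j = v_{m-j}` for `j = 1, …, k`, for some `1 ≤ k ≤ [m/2] - 1`. -/
def HasTail (C : ClosedPath G) : Prop :=
  ∃ k, 1 ≤ k ∧ k + 1 ≤ C.len / 2 ∧ ∀ j, 1 ≤ j → j ≤ k → C.vert j = C.vert (C.len - j)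

/-- Closed paths without backtracking and without tail. -/
def IsReduced (C : ClosedPath G) : Prop := ¬ C.HasBacktracking ∧ ¬ C.HasTail

/-- `C` is not obtained by going `n ≥ 2` times around some closed path `D`. -/
def IsPrimitive (C : ClosedPath G) : Prop :=
  ¬ ∃ (D : ClosedPath G) (n : ℕ), 2 ≤ n ∧ C.len = n * D.len ∧ ∀ j, C.vert j = D.vert j

/-- An automorphism of the graph maps closed paths to closed paths. -/
instance : MulAction (G ≃g G) (ClosedPath G) where
  smul γ C :=
    { len := C.len
      len_pos := C.len_pos
      vert := fun j => γ (C.vert j)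
      periodic := fun j => by rw [C.periodic j]
      adj := fun j => (RelIso.map_rel_iff γ).2 (C.adj j) }
  one_smul _ := rfl
  mul_smul _ _ _ := rfl

theorem vert_smul (γ : G ≃g G) (C : ClosedPath G) (j : ℕ) : (γ • C).vert j = γ (C.vert j) := rfl

theorem len_smul (γ : G ≃g G) (C : ClosedPath G) : (γ • C).len = C.len := rfl

theorem vert_add_mul (C : ClosedPath G) (j n : ℕ) : C.vert (j + n * C.len) = C.vert j := by
  induction n with
  | zero => simp
  | succ n ih => rw [Nat.succ_mul, ← Nat.add_assoc, C.periodic, ih]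

/-- Two closed paths are equivalent if they differ by a shift of the origin. -/
instance setoid (G : SimpleGraph V) : Setoid (ClosedPath G) where
  r C D := D.len = C.len ∧ ∃ k, ∀ j, D.vert j = C.vert (j + k)
  iseqv :=
    { refl := fun _ => ⟨rfl, 0, fun _ => rfl⟩
      symm := by
        rintro C D ⟨h, k, hk⟩
        refine ⟨h.symm, k * C.len - k, fun j => ?_⟩
        have h1 : k ≤ k * C.len := Nat.le_mul_of_pos_right k C.len_pos
        rw [hk, Nat.add_assoc, Nat.sub_add_cancel h1, vert_add_mul]
      trans := by
        rintro C D E ⟨h, k, hk⟩ ⟨h', k', hk'⟩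
        exact ⟨h'.trans h, k' + k, fun j => by rw [hk', hk, Nat.add_assoc]⟩ }

end ClosedPath

/-- Cycles: closed paths up to the choice of the origin. -/
def Cycle (G : SimpleGraph V) : Type _ := Quotient (ClosedPath.setoid G)

namespace Cycle

variable {G : SimpleGraph V}

/-- The length of a cycle. -/
def len : Cycle G → ℕ := Quotient.lift ClosedPath.len fun _ _ h => h.1.symm

/-- The action of graph automorphisms on cycles. -/
instance : MulAction (G ≃g G) (Cycle G) where
  smul γ := Quotient.map (fun C => γ • C)
    (by rintro C D ⟨h, k, hk⟩; exact ⟨h, k, fun j => congrArg γ (hk j)⟩)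
  one_smul := by rintro ⟨C⟩; rfl
  mul_smul := by rintro γ δ ⟨C⟩; rfl

/-- Prime cycles: the classes of primitive reduced closed paths. -/
def IsPrime (c : Cycle G) : Prop :=
  ∃ C : ClosedPath G, C.IsReduced ∧ C.IsPrimitive ∧ Quotient.mk (ClosedPath.setoid G) C = c

end Cycle

/-- The set of prime cycles. -/
def PrimeCycle (G : SimpleGraph V) : Type _ := {c : Cycle G // c.IsPrime}

/-! ### The zeta function of a graph with a group of automorphisms -/

section Zeta

variable {G : SimpleGraph V} (Γ : Subgroup (G ≃g G))

/-- `Γ`-equivalence of prime cycles. -/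
def primeSetoid : Setoid (PrimeCycle G) where
  r c d := ∃ γ ∈ Γ, γ • c.1 = d.1
  iseqv :=
    { refl := fun c => ⟨1, Γ.one_mem, one_smul _ c.1⟩
      symm := by
        rintro c d ⟨γ, hγ, h⟩
        exact ⟨γ⁻¹, Γ.inv_mem hγ, by rw [← h, inv_smul_smul]⟩
      trans := by
        rintro c d e ⟨γ, hγ, h⟩ ⟨δ, hδ, h'⟩
        exact ⟨δ * γ, Γ.mul_mem hδ hγ, by rw [mul_smul, h, h']⟩ }

/-- `Γ`-equivalence classes of prime cycles. -/
def PrimeClass : Type _ := Quotient (primeSetoid Γ)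

/-- The factor `(1 - u^|C|)^(-1/|Γ_C|)` (principal branch), where `Γ_C` is the stabilizer of the
cycle `C` in `Γ`. It only depends on the `Γ`-class of `C`, so a representative is chosen. -/
def zetaFactor (u : ℂ) (c : PrimeClass Γ) : ℂ :=
  let C : Cycle G := (Quotient.out c : PrimeCycle G).1
  (1 - u ^ C.len) ^ (-(1 / (Nat.card (MulAction.stabilizer Γ C) : ℂ)))

/-- The Ihara zeta function, as an (unconditional) infinite product. -/
def zeta (u : ℂ) : ℂ := ∏' c : PrimeClass Γ, zetaFactor Γ u c

/-! ### Free actions and the quotient graph -/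

/-- No element of `Γ` other than the identity fixes a vertex or a geometric edge of the graph
(that is, `Γ` acts freely on the graph as a one-dimensional complex). -/
def ActsFreely : Prop :=
  ∀ γ ∈ Γ, γ ≠ 1 → (∀ v, γ v ≠ v) ∧ ∀ e ∈ G.edgeSet, Sym2.map γ e ≠ e

/-- Two vertices are equivalent if they lie in the same `Γ`-orbit. -/
def vertexSetoid : Setoid V where
  r x y := ∃ γ ∈ Γ, γ x = y
  iseqv :=
    { refl := fun _ => ⟨1, Γ.one_mem, rfl⟩
      symm := by
        rintro x y ⟨γ, hγ, h⟩
        exact ⟨γ⁻¹, Γ.inv_mem hγ, by rw [← h, RelIso.inv_apply_self]⟩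
      trans := by
        rintro x y z ⟨γ, hγ, h⟩ ⟨δ, hδ, h'⟩
        exact ⟨δ * γ, Γ.mul_mem hδ hγ, by rw [RelIso.mul_apply, h, h']⟩ }

/-- Two geometric edges are equivalent if they lie in the same `Γ`-orbit. -/
def edgeSetoid : Setoid G.edgeSet where
  r e f := ∃ γ ∈ Γ, Sym2.map γ e.1 = f.1
  iseqv :=
    { refl := fun e => ⟨1, Γ.one_mem, by rw [RelIso.coe_one, Sym2.map_id]; rfl⟩
      symm := by
        rintro e f ⟨γ, hγ, h⟩
        refine ⟨γ⁻¹, Γ.inv_mem hγ, ?_⟩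
        rw [← h, Sym2.map_map, ← RelIso.coe_mul, inv_mul_cancel, RelIso.coe_one, Sym2.map_id]; rfl
      trans := by
        rintro e f g ⟨γ, hγ, h⟩ ⟨δ, hδ, h'⟩
        exact ⟨δ * γ, Γ.mul_mem hδ hγ, by rw [RelIso.coe_mul, ← Sym2.map_map, h, h']⟩ }

/-- The vertices `VB` of the quotient graph `B = X/Γ`. -/
def QuotVertex : Type _ := Quotient (vertexSetoid Γ)

/-- The geometric edges `EB` of the quotient graph `B = X/Γ`. -/
def QuotEdge : Type _ := Quotient (edgeSetoid Γ)

/-- The Euler characteristic `χ(B) = |VB| - |EB|` of the quotient graph. -/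
def eulerChar : ℤ := (Nat.card (QuotVertex Γ) : ℤ) - (Nat.card (QuotEdge Γ) : ℤ)

/-- `F` contains exactly one vertex from every `Γ`-orbit. -/
def IsRepresentatives (F : Finset V) : Prop := ∀ x : V, ∃! y, y ∈ F ∧ ∃ γ ∈ Γ, γ x = y

end Zeta

/-! ### Operators on `ℓ²(V)` -/

/-- The Hilbert space `ℓ²(V)`. -/
abbrev L2 (V : Type*) := lp (fun _ : V => ℂ) 2

theorem memL2_iff (f : V → ℂ) :
    Memℓp (E := fun _ : V => ℂ) f 2 ↔ ∑' x, ‖f x‖ₑ ^ 2 ≠ ⊤ := by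
  have h : ∀ x, ‖f x‖ₑ ^ 2 = ENNReal.ofReal (‖f x‖ ^ 2) := fun x => by
    rw [← ofReal_norm, ENNReal.ofReal_pow (norm_nonneg _)]
  have h2 : Memℓp (E := fun _ : V => ℂ) f 2 ↔ Summable fun x => ‖f x‖ ^ 2 := by
    rw [memℓp_gen_iff (by norm_num)]
    simp
  simp_rw [h]
  rw [h2]
  refine ⟨fun hs => hs.tsum_ofReal_ne_top, fun hs => ?_⟩
  have := ENNReal.summable_toReal hs
  simpa [ENNReal.toReal_ofReal, sq_nonneg] using this

theorem enorm_sq_eq (f : L2 V) : ∑' x, ‖f x‖ₑ ^ 2 = ENNReal.ofReal (‖f‖ ^ 2) := by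
  have h : ∀ x, ‖f x‖ₑ ^ 2 = ENNReal.ofReal (‖f x‖ ^ 2) := fun x => by
    rw [← ofReal_norm, ENNReal.ofReal_pow (norm_nonneg _)]
  have hs : HasSum (fun x => ‖f x‖ ^ 2) (‖f‖ ^ 2) := by
    simpa using lp.hasSum_norm (p := 2) (by norm_num) f
  simp_rw [h]
  rw [← ENNReal.ofReal_tsum_of_nonneg (fun x => sq_nonneg _) hs.summable, hs.tsum_eq]

/-- A linear map on functions that is bounded for the `ℓ²` norm gives a bounded operator. -/
def opOfBound (T : (V → ℂ) →ₗ[ℂ] (V → ℂ)) (c : ℝ)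
    (h : ∀ f : V → ℂ, ∑' x, ‖T f x‖ₑ ^ 2 ≤ ENNReal.ofReal (c ^ 2) * ∑' x, ‖f x‖ₑ ^ 2) :
    L2 V →L[ℂ] L2 V :=
  LinearMap.mkContinuous
    { toFun := fun f => ⟨T f, (memL2_iff _).2 <| ne_top_of_le_ne_top
        (ENNReal.mul_ne_top ENNReal.ofReal_ne_top ((memL2_iff _).1 (lp.memℓp f))) (h f)⟩
      map_add' := fun f g => lp.ext (T.map_add f g)
      map_smul' := fun a f => lp.ext (T.map_smul a f) }
    |c| (by
      intro f
      rw [← abs_of_nonneg (norm_nonneg f), ← abs_mul]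
      refine abs_le_of_sq_le_sq' ?_ (abs_nonneg _) |>.2
      have h1 := h f
      rw [enorm_sq_eq, ← ENNReal.ofReal_mul (sq_nonneg c)] at h1
      rw [sq_abs, mul_pow]
      refine (ENNReal.ofReal_le_ofReal_iff (by positivity)).1 (le_trans (le_of_eq ?_) h1)
      exact (enorm_sq_eq _).symm)

theorem opOfBound_apply (T : (V → ℂ) →ₗ[ℂ] (V → ℂ)) (c : ℝ)
    (h : ∀ f : V → ℂ, ∑' x, ‖T f x‖ₑ ^ 2 ≤ ENNReal.ofReal (c ^ 2) * ∑' x, ‖f x‖ₑ ^ 2)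
    (f : L2 V) (x : V) : opOfBound T c h f x = T f x := rfl

section Operators

variable (G : SimpleGraph V) [G.LocallyFinite]

theorem adj_bound (d : ℕ) (hd : ∀ v, G.degree v ≤ d) (f : V → ℂ) :
    ∑' x, ‖∑ y ∈ G.neighborFinset x, f y‖ₑ ^ 2 ≤
      ENNReal.ofReal ((d : ℝ) ^ 2) * ∑' x, ‖f x‖ₑ ^ 2 := by
  classical
  have h1 : ∀ x, ‖∑ y ∈ G.neighborFinset x, f y‖ₑ ^ 2 ≤
      d * ∑' y, if G.Adj x y then ‖f y‖ₑ ^ 2 else 0 := by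
    intro x
    have ha : ∑' y, (if G.Adj x y then ‖f y‖ₑ ^ 2 else 0) =
        ∑ y ∈ G.neighborFinset x, ‖f y‖ₑ ^ 2 := by
      rw [tsum_eq_sum (s := G.neighborFinset x)]
      · exact Finset.sum_congr rfl fun y hy => if_pos ((G.mem_neighborFinset x y).1 hy)
      · exact fun y hy => if_neg fun h => hy ((G.mem_neighborFinset x y).2 h)
    have hb : ‖∑ y ∈ G.neighborFinset x, f y‖ ^ 2 ≤
        d * ∑ y ∈ G.neighborFinset x, ‖f y‖ ^ 2 := by
      calc ‖∑ y ∈ G.neighborFinset x, f y‖ ^ 2 ≤ (∑ y ∈ G.neighborFinset x, ‖f y‖) ^ 2 := by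
            gcongr; exact norm_sum_le _ _
        _ ≤ G.degree x * ∑ y ∈ G.neighborFinset x, ‖f y‖ ^ 2 := sq_sum_le_card_mul_sum_sq
        _ ≤ d * ∑ y ∈ G.neighborFinset x, ‖f y‖ ^ 2 := by
            gcongr; exact hd x
    have hc := ENNReal.ofReal_le_ofReal hb
    rw [ENNReal.ofReal_mul (by positivity), ENNReal.ofReal_natCast,
      ENNReal.ofReal_sum_of_nonneg fun _ _ => sq_nonneg _, ENNReal.ofReal_pow (norm_nonneg _),
      ofReal_norm] at hc
    rw [ha]
    refine hc.trans (le_of_eq ?_)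
    congr 1
    exact Finset.sum_congr rfl fun y _ => by
      rw [ENNReal.ofReal_pow (norm_nonneg _), ofReal_norm]
  have h2 : ∀ y, ∑' x, (if G.Adj x y then ‖f y‖ₑ ^ 2 else 0) ≤ d * ‖f y‖ₑ ^ 2 := by
    intro y
    rw [tsum_eq_sum (s := G.neighborFinset y)]
    · calc ∑ x ∈ G.neighborFinset y, (if G.Adj x y then ‖f y‖ₑ ^ 2 else 0)
          ≤ ∑ x ∈ G.neighborFinset y, ‖f y‖ₑ ^ 2 :=
            Finset.sum_le_sum fun x _ => by split_ifs <;> simp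
        _ = G.degree y * ‖f y‖ₑ ^ 2 := by
            rw [Finset.sum_const, nsmul_eq_mul, SimpleGraph.card_neighborFinset_eq_degree]
        _ ≤ d * ‖f y‖ₑ ^ 2 := by
            gcongr; exact hd y
    · exact fun x hx => if_neg fun h => hx ((G.mem_neighborFinset y x).2 h.symm)
  calc ∑' x, ‖∑ y ∈ G.neighborFinset x, f y‖ₑ ^ 2
      ≤ ∑' x, d * ∑' y, (if G.Adj x y then ‖f y‖ₑ ^ 2 else 0) := ENNReal.tsum_le_tsum h1
    _ = d * ∑' y, ∑' x, (if G.Adj x y then ‖f y‖ₑ ^ 2 else 0) := by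
        rw [ENNReal.tsum_mul_left, ENNReal.tsum_comm]
    _ ≤ d * ∑' y, d * ‖f y‖ₑ ^ 2 := by
        gcongr with y; exact h2 y
    _ = ENNReal.ofReal ((d : ℝ) ^ 2) * ∑' x, ‖f x‖ₑ ^ 2 := by
        rw [ENNReal.tsum_mul_left, ← mul_assoc, ENNReal.ofReal_pow (by positivity),
          ENNReal.ofReal_natCast, sq]

/-- The adjacency operator `(A f)(x) = ∑_{y ∼ x} f(y)` on `ℓ²(V)`, for a graph whose degrees are
bounded by `d`. -/
def adjOp (d : ℕ) (hd : ∀ v, G.degree v ≤ d) : L2 V →L[ℂ] L2 V :=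
  opOfBound
    { toFun := fun f x => ∑ y ∈ G.neighborFinset x, f y
      map_add' := fun _ _ => funext fun _ => Finset.sum_add_distrib
      map_smul' := fun _ _ => funext fun _ => (Finset.mul_sum _ _ _).symm }
    d (adj_bound G d hd)

/-- The operator `Q = diag(deg(v) - 1)` on `ℓ²(V)`, for a graph whose degrees are bounded by `d`. -/
def degOp (d : ℕ) (hd : ∀ v, G.degree v ≤ d) : L2 V →L[ℂ] L2 V :=
  opOfBound
    { toFun := fun f x => ((G.degree x : ℂ) - 1) * f x
      map_add' := fun _ _ => funext fun _ => mul_add _ _ _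
      map_smul' := fun _ _ => funext fun _ => mul_left_comm _ _ _ }
    (d + 1) (by
      intro f
      rw [← ENNReal.tsum_mul_left]
      refine ENNReal.tsum_le_tsum fun x => ?_
      have hx : (G.degree x : ℝ) ≤ d := by exact_mod_cast hd x
      have h1 : ‖(G.degree x : ℂ) - 1‖ ≤ d + 1 := by
        refine (norm_sub_le _ _).trans ?_
        simpa using hx
      have h2 : ‖(G.degree x : ℂ) - 1‖ₑ ≤ ENNReal.ofReal (d + 1) := by
        rw [← ofReal_norm]
        exact ENNReal.ofReal_le_ofReal h1
      change ‖((G.degree x : ℂ) - 1) * f x‖ₑ ^ 2 ≤ _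
      rw [enorm_mul, mul_pow, ENNReal.ofReal_pow (by positivity)]
      gcongr)

end Operators

section Determinant

/-- The unitary `(λ(γ) f)(x) = f(γ⁻¹ x)` on `ℓ²(V)`. -/
def regRep {G : SimpleGraph V} (γ : G ≃g G) : L2 V →L[ℂ] L2 V :=
  opOfBound
    { toFun := fun f x => f (γ⁻¹ x)
      map_add' := fun _ _ => rfl
      map_smul' := fun _ _ => rfl }
    1 (by
      intro f
      have h := (RelIso.toEquiv γ⁻¹).tsum_eq fun x => ‖f x‖ₑ ^ 2
      simpa using h.le)

/-- The von Neumann algebra `𝒩(X, Γ) = {λ(γ) : γ ∈ Γ}'` of bounded operators on `ℓ²(V)` that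
commute with the action of `Γ`. -/
def groupAlg {G : SimpleGraph V} (Γ : Subgroup (G ≃g G)) : Subalgebra ℂ (L2 V →L[ℂ] L2 V) :=
  Subalgebra.centralizer ℂ {T | ∃ γ ∈ Γ, T = regRep γ}

open Classical in
/-- The trace `Tr_Γ(T) = ∑_{x ∈ F} T(x, x)`, with `F` a set of representatives of the vertices
modulo `Γ`. -/
def trace (F : Finset V) (T : L2 V →L[ℂ] L2 V) : ℂ :=
  ∑ x ∈ F, T (lp.single 2 x (1 : ℂ)) x

/-- The `L²`-Euler characteristic `-½ Tr_Γ(Q - I)` of a graph whose degrees are bounded by `d`. -/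
def l2EulerChar (G : SimpleGraph V) [G.LocallyFinite] (d : ℕ) (hd : ∀ v, G.degree v ≤ d)
    (F : Finset V) : ℂ :=
  -(1 / 2) * trace F (degOp G d hd - 1)

variable {H : Type*} [NormedAddCommGroup H] [NormedSpace ℂ H]

/-- The data needed to form `log T`: a disc `Ω` containing `conv σ(T)` and a branch `log` of the
logarithm on the closure of `Ω`. Since a compact convex set that misses the origin lies in a disc
whose closure misses the origin, such data exist precisely when `0 ∉ conv σ(T)`. -/
structure LogData (T : H →L[ℂ] H) where
  center : ℂ
  radius : ℝ
  radius_pos : 0 < radius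
  conv_subset : convexHull ℝ (spectrum ℂ T) ⊆ Metric.ball center radius
  /-- the branch of the logarithm -/
  log : ℂ → ℂ
  log_continuousOn : ContinuousOn log (Metric.closedBall center radius)
  exp_log : ∀ z ∈ Metric.closedBall center radius, Complex.exp (log z) = z

/-- `(2πi)⁻¹ ∫_{∂Ω} log λ (λ - T)⁻¹ dλ`. -/
def LogData.logOp {T : H →L[ℂ] H} (D : LogData T) : H →L[ℂ] H :=
  (2 * Real.pi * Complex.I : ℂ)⁻¹ • ∮ z in C(D.center, D.radius), D.log z • resolvent T z

open Classical in
/-- The analytic determinant `det_τ(T) = exp (τ (log T))`, defined for `0 ∉ conv σ(T)`. The value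
does not depend on the chosen disc and branch. Where it is not defined the value is `0`. -/
def analyticDet (τ : (H →L[ℂ] H) → ℂ) (T : H →L[ℂ] H) : ℂ :=
  if h : Nonempty (LogData T) then Complex.exp (τ h.some.logOp) else 0

end Determinant

section Regular

variable (G : SimpleGraph V) [G.LocallyFinite]

/-- `Δ(u) = (1 + q u²) I - u A` for a `(q+1)`-regular graph. -/
def deformedLaplacian (q : ℕ) (hG : G.IsRegularOfDegree (q + 1)) (u : ℂ) : L2 V →L[ℂ] L2 V :=
  (1 + q * u ^ 2) • (1 : L2 V →L[ℂ] L2 V) - u • adjOp G (q + 1) fun v => (hG v).le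

end Regular

/-- The plane minus the circle `|u| = 1/√q` and the real segments `1/q ≤ |x| ≤ 1`. -/
def holomorphyDomain (q : ℕ) : Set ℂ :=
  ({u : ℂ | u.re ^ 2 + u.im ^ 2 = 1 / (q : ℝ)} ∪
    {u : ℂ | u.im = 0 ∧ 1 / (q : ℝ) ≤ |u.re| ∧ |u.re| ≤ 1})ᶜ

end PeriodicGraph

end

/-!
The operator `Δ(u)` is the value of `x ↦ 1 + q u² - u x` at the self-adjoint adjacency operator `A`,
whose spectrum lies in `[-(q + 1), q + 1]`. The image of this interval is a segment, which avoids
`0` exactly for `u ∈ Ω`. For a normal operator the contour integral of the logarithm is the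
functional calculus of the logarithm, hence the determinant may be computed with any continuous
logarithm on a compact convex set that contains the spectrum. The functional equation follows from
`Δ(1/(qu)) = (qu²)⁻¹ Δ(u)`, and holomorphy from the power series of the logarithm.

For `|u| < 1/q`, factor `1 + q u² - u x = (1 - α u) (1 - β u)` with `α + β = x` and `α β = q`. The
power sums `αᵐ + βᵐ` are the Dickson polynomials `Dₘ(x, q)`, so that
`-log det_Γ Δ(u) = ∑ Tr_Γ Dₘ(A, q) uᵐ / m`.

On the other side, the trace modulo `Γ` of the `m`-th power of Hashimoto's edge operator counts the
reduced closed paths of length `m` that start in `F`. A three-term recurrence shows that it differs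
from `Tr_Γ Dₘ(A, q)` by `(q - 1) |F|` for even `m` and not at all for odd `m`, which accounts for
the factor `(1 - u²)^χ(B)`. Every reduced closed path is a power of a unique primitive one, and
because `Γ` acts freely, a class `[C]_Γ` contains `|C| / |Γ_C|` primitive reduced closed paths that
start in `F`; hence the power series of these counts is the logarithm of the Euler product.
-/

noncomputable section

open Filter Topology

namespace PeriodicGraph

section Logarithm

theorem exists_eqOn_add_int_mul_two_pi_I {l₁ l₂ : ℂ → ℂ} {S : Set ℂ} (hS : IsPreconnected S)
    (h₁ : ContinuousOn l₁ S) (h₂ : ContinuousOn l₂ S)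
    (hexp : ∀ z ∈ S, Complex.exp (l₁ z) = Complex.exp (l₂ z)) :
    ∃ k : ℤ, Set.EqOn l₁ (fun z => l₂ z + k * (2 * Real.pi * Complex.I)) S := by
  rcases S.eq_empty_or_nonempty with rfl | ⟨z₀, hz₀⟩
  · exact ⟨0, Set.eqOn_empty _ _⟩
  choose! k hk using fun z hz => Complex.exp_eq_exp_iff_exists_int.1 (hexp z hz)
  have hk_eq : ∀ z ∈ S, ((l₁ z - l₂ z) / (2 * Real.pi * Complex.I)).re = k z := fun z hz => by
    rw [hk z hz, add_sub_cancel_left, mul_div_cancel_right₀ _ Complex.two_pi_I_ne_zero,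
      Complex.intCast_re]
  have hk_cont : ContinuousOn (fun z => (k z : ℝ)) S :=
    (Complex.continuous_re.comp_continuousOn ((h₁.sub h₂).div_const _)).congr
      fun z hz => (hk_eq z hz).symm
  refine ⟨k z₀, fun z hz => ?_⟩
  have hk_const : (k z : ℝ) = k z₀ := hS.constant_of_mapsTo (T := Set.range ((↑) : ℤ → ℝ))
    Int.isClosedEmbedding_coe_real.isEmbedding.isDiscrete_range hk_cont
    (fun z _ => ⟨k z, rfl⟩) hz hz₀
  rw [hk z hz, Int.cast_injective hk_const]

theorem exists_subset_ball_of_zero_notMem {E : Type*} [NormedAddCommGroup E]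
    [InnerProductSpace ℝ E] [ProperSpace E] [Nontrivial E] {K : Set E} (hK : IsCompact K)
    (hconv : Convex ℝ K) (h0 : 0 ∉ K) :
    ∃ c : E, ∃ r ∈ Set.Ioo 0 ‖c‖, K ⊆ Metric.ball c r := by
  suffices ∃ c : E, c ≠ 0 ∧ K ⊆ Metric.ball c ‖c‖ by
    obtain ⟨c, hc, hKc⟩ := this
    exact ⟨c, exists_pos_lt_subset_ball (norm_pos_iff.2 hc) hK.isClosed hKc⟩
  rcases K.eq_empty_or_nonempty with rfl | hne
  · exact (exists_ne (0 : E)).imp fun c hc => ⟨hc, Set.empty_subset _⟩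
  obtain ⟨p, hpK, hp⟩ := exists_norm_eq_iInf_of_complete_convex hne hK.isComplete hconv 0
  have hp0 : 0 < ‖p‖ := norm_pos_iff.2 (ne_of_mem_of_not_mem hpK h0)
  have hinner : ∀ w ∈ K, ‖p‖ ^ 2 ≤ inner ℝ w p := fun w hw => by
    have h := (norm_eq_iInf_iff_real_inner_le_zero hconv hpK).1 hp w hw
    rw [zero_sub, inner_neg_left, inner_sub_right, real_inner_self_eq_norm_sq,
      real_inner_comm] at h
    linarith
  obtain ⟨M, hM⟩ := hK.exists_bound_of_continuousOn (f := id) continuousOn_id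
  have ht : 0 < (M ^ 2 + 1) / ‖p‖ ^ 2 := by positivity
  refine ⟨((M ^ 2 + 1) / ‖p‖ ^ 2) • p, smul_ne_zero ht.ne' (norm_pos_iff.1 hp0), fun w hw => ?_⟩
  rw [mem_ball_iff_norm]
  refine lt_of_pow_lt_pow_left₀ 2 (norm_nonneg _) ?_
  have hwM : ‖w‖ ^ 2 ≤ M ^ 2 := pow_le_pow_left₀ (norm_nonneg w) (hM w hw) 2
  have hwp : M ^ 2 + 1 ≤ (M ^ 2 + 1) / ‖p‖ ^ 2 * inner ℝ w p := by
    rw [div_mul_eq_mul_div, le_div_iff₀ (by positivity)]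
    gcongr
    exact hinner w hw
  rw [norm_sub_sq_real, real_inner_smul_right]
  linarith [sq_nonneg M]

theorem div_mem_slitPlane {c z : ℂ} (h : ‖z - c‖ < ‖c‖) : z / c ∈ Complex.slitPlane := by
  have hc : 0 < ‖c‖ := (norm_nonneg _).trans_lt h
  have hz : z / c = 1 + (z - c) / c := by
    rw [sub_div, div_self (norm_pos_iff.1 hc), add_sub_cancel]
  rw [hz]
  exact Complex.mem_slitPlane_of_norm_lt_one (by rwa [norm_div, div_lt_one hc])

theorem norm_div_natCast_le (z : ℂ) (k : ℕ) : ‖z / k‖ ≤ ‖z‖ := by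
  rcases k.eq_zero_or_pos with rfl | hk
  · simp
  · rw [norm_div, Complex.norm_natCast]
    exact div_le_self (norm_nonneg z) (Nat.one_le_cast.2 hk)

end Logarithm

/-! ### Functional calculus and the determinant -/

section FunctionalCalculus

variable {A : Type*} [NormedRing A] [StarRing A] [NormedAlgebra ℂ A]
  [IsometricContinuousFunctionalCalculus ℂ A IsStarNormal]

theorem resolvent_eq_cfc (a : A) [IsStarNormal a] {z : ℂ} (hz : z ∉ spectrum ℂ a) :
    resolvent a z = cfc (fun x => (z - x)⁻¹) a := by
  have hne : ∀ x ∈ spectrum ℂ a, z - x ≠ 0 := fun x hx h => hz (sub_eq_zero.1 h ▸ hx)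
  rw [cfc_inv _ a hne, cfc_sub _ _ a, cfc_const z a, cfc_id' ℂ a, resolvent]

theorem hasSum_cfc {f : ℕ → ℂ → ℂ} (a : A) [IsStarNormal a]
    (hf : ∀ k, ContinuousOn (f k) (spectrum ℂ a)) {b : ℕ → ℝ} (hb : Summable b)
    (hfb : ∀ k, ∀ x ∈ spectrum ℂ a, ‖f k x‖ ≤ b k) [CompleteSpace A] :
    HasSum (fun k => cfc (f k) a) (cfc (fun x => ∑' k, f k x) a) := by
  have hsummable : Summable fun k => cfc (f k) a := by
    refine Summable.of_norm_bounded hb.abs fun k => norm_cfc_le (abs_nonneg _) fun x hx => ?_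
    exact (hfb k x hx).trans (le_abs_self _)
  have hlim : Tendsto (fun N => cfc (fun x => ∑ k ∈ Finset.range N, f k x) a) atTop
      (𝓝 (cfc (fun x => ∑' k, f k x) a)) :=
    tendsto_cfc_fun (tendstoUniformlyOn_tsum_nat hb hfb)
      (Eventually.of_forall fun N => continuousOn_finsetSum _ fun k _ => hf k)
  refine (hsummable.hasSum_iff_tendsto_nat).2 (hlim.congr fun N => ?_)
  rw [← Finset.sum_fn, cfc_sum f a _ fun k _ => hf k]

theorem circleIntegral_cfc [CompleteSpace A] (a : A) [IsStarNormal a] {c : ℂ} {r : ℝ} (hr : 0 ≤ r)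
    {f : ℂ → ℂ → ℂ}
    (hf : ContinuousOn (Function.uncurry f) (Metric.sphere c r ×ˢ spectrum ℂ a)) :
    ∮ z in C(c, r), cfc (f z) a = cfc (fun x => ∮ z in C(c, r), f z x) a := by
  let g : ℝ → ℂ → ℂ := fun θ x => deriv (circleMap c r) θ * f (circleMap c r θ) x
  have hsec : ∀ θ : ℝ, ContinuousOn (f (circleMap c r θ)) (spectrum ℂ a) := fun θ =>
    hf.comp (f := fun x => (circleMap c r θ, x)) (by fun_prop) fun x hx =>
      ⟨circleMap_mem_sphere _ hr _, hx⟩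
  have hg : ContinuousOn (Function.uncurry g) (Set.univ ×ˢ spectrum ℂ a) := by
    refine ContinuousOn.mul ?_ (hf.comp (f := fun p : ℝ × ℂ => (circleMap c r p.1, p.2)) ?_ ?_)
    · simp only [deriv_circleMap]
      fun_prop
    · fun_prop
    · exact fun p hp => ⟨circleMap_mem_sphere _ hr _, hp.2⟩
  obtain ⟨M, hM⟩ := ((isCompact_Icc (a := (0 : ℝ)) (b := 2 * Real.pi)).prod
    (spectrum.isCompact a)).exists_bound_of_continuousOn
      (hg.mono (Set.prod_mono (Set.subset_univ _) le_rfl))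
  have hint := cfc_setIntegral (s := Set.Ioc 0 (2 * Real.pi)) (μ := MeasureTheory.volume)
    measurableSet_Ioc g (fun _ => M) a (hg.mono (Set.prod_mono (Set.subset_univ _) le_rfl))
    (MeasureTheory.ae_restrict_of_forall_mem measurableSet_Ioc fun θ hθ x hx =>
      hM (θ, x) ⟨Set.Ioc_subset_Icc_self hθ, hx⟩)
    (MeasureTheory.integrable_const M).hasFiniteIntegral
  simp only [circleIntegral, intervalIntegral.integral_of_le Real.two_pi_pos.le]
  refine Eq.trans ?_ hint.symm
  exact MeasureTheory.integral_congr_ae <| Eventually.of_forall fun θ =>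
    (cfc_const_mul _ _ a (hsec θ)).symm

theorem cfc_sub_const_eq (a : A) [IsStarNormal a] (c : ℂ) : cfc (fun z => z - c) a = a - c • 1 := by
  rw [cfc_sub _ _ a, cfc_const c a, cfc_id' ℂ a, Algebra.algebraMap_eq_smul_one]

theorem spectrum_subset_closedBall (a : A) [IsStarNormal a] (c : ℂ) :
    spectrum ℂ a ⊆ Metric.closedBall c ‖a - c • 1‖ := fun z hz => by
  rw [mem_closedBall_iff_norm, ← cfc_sub_const_eq]
  exact norm_apply_le_norm_cfc (fun z => z - c) a hz

theorem hasSum_neg_cfc_log_div [CompleteSpace A] (a : A) [IsStarNormal a] {c : ℂ}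
    (hac : ‖a - c • 1‖ < ‖c‖) :
    HasSum (fun k : ℕ => (k : ℂ)⁻¹ • (1 - c⁻¹ • a) ^ k)
      (-cfc (fun z => Complex.log (z / c)) a) := by
  have hc : 0 < ‖c‖ := (norm_nonneg _).trans_lt hac
  have hratio : ‖a - c • 1‖ / ‖c‖ < 1 := (div_lt_one hc).2 hac
  have hbound : ∀ z ∈ spectrum ℂ a, ‖1 - z / c‖ ≤ ‖a - c • 1‖ / ‖c‖ := fun z hz => by
    rw [← div_self (norm_pos_iff.1 hc), ← sub_div, norm_div, norm_sub_rev]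
    gcongr
    exact mem_closedBall_iff_norm.1 (spectrum_subset_closedBall a c hz)
  have hpow : ∀ k : ℕ, cfc (fun z => (1 - z / c) ^ k / k) a =
      (k : ℂ)⁻¹ • (1 - c⁻¹ • a) ^ k := fun k => by
    have hlin : cfc (fun z => 1 - c⁻¹ * z) a = 1 - c⁻¹ • a := by
      rw [cfc_sub _ _ a, cfc_const_one ℂ a, cfc_const_mul_id c⁻¹ a]
    simp only [div_eq_inv_mul]
    rw [cfc_const_mul _ _ a, cfc_pow _ _ a, hlin]
  have htaylor : Set.EqOn (fun z => ∑' k : ℕ, (1 - z / c) ^ k / (k : ℂ))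
      (fun z => -Complex.log (z / c)) (spectrum ℂ a) := fun z hz => by
    simpa only [sub_sub_cancel] using
      (Complex.hasSum_taylorSeries_neg_log ((hbound z hz).trans_lt hratio)).tsum_eq
  have hseries := hasSum_cfc a (f := fun k z => (1 - z / c) ^ k / k)
    (fun k => by fun_prop) (summable_geometric_of_lt_one (by positivity) hratio)
    fun k z hz => (norm_div_natCast_le _ k).trans <| by
      rw [norm_pow]
      exact pow_le_pow_left₀ (norm_nonneg _) (hbound z hz) k
  rw [cfc_congr htaylor, cfc_neg] at hseries
  simpa only [hpow] using hseries

end FunctionalCalculus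

section Determinant

variable {H : Type*} [NormedAddCommGroup H]

theorem norm_pow_le_pow_norm [NormedSpace ℂ H] (T : H →L[ℂ] H) (k : ℕ) : ‖T ^ k‖ ≤ ‖T‖ ^ k := by
  rcases k.eq_zero_or_pos with rfl | hk
  · simpa only [pow_zero] using! ContinuousLinearMap.norm_id_le
  · exact norm_pow_le' T hk

namespace LogData

variable [NormedSpace ℂ H] {T : H →L[ℂ] H} (D : LogData T)

theorem spectrum_subset_ball : spectrum ℂ T ⊆ Metric.ball D.center D.radius :=
  (subset_convexHull ℝ _).trans D.conv_subset

theorem log_continuousOn_ball : ContinuousOn D.log (Metric.ball D.center D.radius) :=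
  D.log_continuousOn.mono Metric.ball_subset_closedBall

theorem hasDerivAt_log {z : ℂ} (hz : z ∈ Metric.ball D.center D.radius) :
    HasDerivAt D.log (Complex.exp (D.log z))⁻¹ z := by
  have hnhds : Metric.closedBall D.center D.radius ∈ 𝓝 z :=
    mem_of_superset (Metric.isOpen_ball.mem_nhds hz) Metric.ball_subset_closedBall
  refine HasDerivAt.of_local_left_inverse (D.log_continuousOn.continuousAt hnhds)
    (Complex.hasDerivAt_exp _) (Complex.exp_ne_zero _) ?_
  filter_upwards [hnhds] with w hw using D.exp_log w hw

theorem circleIntegral_log_mul_inv_sub {w : ℂ} (hw : w ∈ Metric.ball D.center D.radius) :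
    ∮ z in C(D.center, D.radius), D.log z * (z - w)⁻¹ = 2 * Real.pi * Complex.I * D.log w := by
  have h := Complex.two_pi_I_inv_smul_circleIntegral_sub_inv_smul_of_differentiable_on_off_countable
    Set.countable_empty hw D.log_continuousOn fun z hz => (D.hasDerivAt_log hz.1).differentiableAt
  rw [smul_eq_mul, inv_mul_eq_iff_eq_mul₀ Complex.two_pi_I_ne_zero] at h
  simpa only [smul_eq_mul, mul_comm] using h

end LogData

theorem nonempty_logData [NormedSpace ℂ H] {T : H →L[ℂ] H} {K : Set ℂ} (hK : IsCompact K)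
    (hconv : Convex ℝ K) (h0 : 0 ∉ K) (hTK : spectrum ℂ T ⊆ K) : Nonempty (LogData T) := by
  obtain ⟨c, r, ⟨hr, hrc⟩, hsub⟩ := exists_subset_ball_of_zero_notMem hK hconv h0
  have hslit : ∀ z ∈ Metric.closedBall c r, z / c ∈ Complex.slitPlane := fun z hz =>
    div_mem_slitPlane ((mem_closedBall_iff_norm.1 hz).trans_lt hrc)
  have hc : c ≠ 0 := norm_pos_iff.1 (hr.trans hrc)
  exact ⟨{
    center := c
    radius := r
    radius_pos := hr
    conv_subset := (convexHull_min hTK hconv).trans hsub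
    log := fun z => Complex.log c + Complex.log (z / c)
    log_continuousOn := continuousOn_const.add ((continuousOn_id.div_const c).clog hslit)
    exp_log := fun z hz => by
      rw [Complex.exp_add, Complex.exp_log hc, Complex.exp_log (Complex.slitPlane_ne_zero
        (hslit z hz)), mul_div_cancel₀ _ hc] }⟩

theorem analyticDet_ne_zero [NormedSpace ℂ H] (τ : (H →L[ℂ] H) → ℂ) {T : H →L[ℂ] H}
    (hT : Nonempty (LogData T)) : analyticDet τ T ≠ 0 := by
  rw [analyticDet, dif_pos hT]
  exact Complex.exp_ne_zero _

variable [InnerProductSpace ℂ H] [CompleteSpace H]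

theorem LogData.logOp_eq_cfc {T : H →L[ℂ] H} [IsStarNormal T] (D : LogData T) :
    D.logOp = cfc D.log T := by
  have hsphere : ∀ z ∈ Metric.sphere D.center D.radius, ∀ x ∈ spectrum ℂ T, z - x ≠ 0 := by
    intro z hz x hx hzx
    rw [sub_eq_zero.1 hzx] at hz
    exact (Metric.mem_ball.1 (D.spectrum_subset_ball hx)).ne hz
  have hint : ContinuousOn (Function.uncurry fun z x => D.log z * (z - x)⁻¹)
      (Metric.sphere D.center D.radius ×ˢ spectrum ℂ T) :=
    (D.log_continuousOn.comp continuousOn_fst fun p hp => Metric.sphere_subset_closedBall hp.1).mul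
      ((continuousOn_fst.sub continuousOn_snd).inv₀ fun p hp => hsphere p.1 hp.1 p.2 hp.2)
  have hresolvent : Set.EqOn (fun z => D.log z • resolvent T z)
      (fun z => cfc (fun x => D.log z * (z - x)⁻¹) T) (Metric.sphere D.center D.radius) := by
    intro z hz
    have hcont : ContinuousOn (fun x => (z - x)⁻¹) (spectrum ℂ T) :=
      (continuousOn_const.sub continuousOn_id).inv₀ (hsphere z hz)
    simp only [cfc_const_mul (D.log z) _ T hcont,
      resolvent_eq_cfc T fun h => hsphere z hz z h (sub_self z)]
  rw [logOp, circleIntegral.integral_congr D.radius_pos.le hresolvent,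
    circleIntegral_cfc T D.radius_pos.le hint,
    cfc_congr fun x hx => D.circleIntegral_log_mul_inv_sub (D.spectrum_subset_ball hx),
    cfc_const_mul _ _ T (D.log_continuousOn_ball.mono D.spectrum_subset_ball),
    inv_smul_smul₀ Complex.two_pi_I_ne_zero]

variable (τ : (H →L[ℂ] H) →L[ℂ] ℂ) {n : ℕ}

theorem analyticDet_eq_exp_cfc (hτ : τ 1 = n) {T : H →L[ℂ] H} [IsStarNormal T] {K : Set ℂ}
    (hK : IsCompact K) (hconv : Convex ℝ K) (hTK : spectrum ℂ T ⊆ K) {l : ℂ → ℂ}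
    (hl : ContinuousOn l K) (hexp : ∀ z ∈ K, Complex.exp (l z) = z) :
    analyticDet τ T = Complex.exp (τ (cfc l T)) := by
  have h0 : (0 : ℂ) ∉ K := fun h => Complex.exp_ne_zero _ (hexp 0 h)
  obtain ⟨D, hD⟩ : ∃ D : LogData T, analyticDet τ T = Complex.exp (τ D.logOp) :=
    have hT := nonempty_logData hK hconv h0 hTK
    ⟨hT.some, by rw [analyticDet, dif_pos hT]⟩
  obtain ⟨k, hk⟩ := exists_eqOn_add_int_mul_two_pi_I
    ((convex_ball D.center D.radius).inter hconv).isPreconnected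
    (D.log_continuousOn_ball.mono Set.inter_subset_left) (hl.mono Set.inter_subset_right)
    fun z hz => by rw [D.exp_log z (Metric.ball_subset_closedBall hz.1), hexp z hz.2]
  have hlog : D.logOp = cfc l T + (k * (2 * Real.pi * Complex.I) : ℂ) • 1 := by
    rw [D.logOp_eq_cfc, cfc_congr fun z hz => hk ⟨D.spectrum_subset_ball hz, hTK hz⟩,
      cfc_add_const _ l T (hl.mono hTK), Algebra.algebraMap_eq_smul_one]
  have hperiod : (k * (2 * Real.pi * Complex.I)) * n =
      ((k * n : ℤ) : ℂ) * (2 * Real.pi * Complex.I) := by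
    push_cast; ring
  rw [hD, hlog, map_add, map_smul, hτ, smul_eq_mul, hperiod, Complex.exp_add,
    Complex.exp_int_mul_two_pi_mul_I, mul_one]

theorem analyticDet_one (hτ : τ 1 = n) : analyticDet τ 1 = 1 := by
  have hlog : cfc (fun _ => (0 : ℂ)) (1 : H →L[ℂ] H) = 0 := cfc_const_zero ℂ _
  rw [analyticDet_eq_exp_cfc τ hτ (K := {1}) isCompact_singleton (convex_singleton 1)
    (by simpa using CFC.spectrum_algebraMap_subset (A := H →L[ℂ] H) (1 : ℂ)) continuousOn_const
    (fun z hz => by rw [Complex.exp_zero, Set.mem_singleton_iff.1 hz]), hlog, map_zero,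
    Complex.exp_zero]

open scoped Pointwise in
theorem analyticDet_smul (hτ : τ 1 = n) {T : H →L[ℂ] H} [IsStarNormal T]
    (hT : Nonempty (LogData T)) {a : ℂ} (ha : a ≠ 0) :
    analyticDet τ (a • T) = a ^ n * analyticDet τ T := by
  obtain ⟨D⟩ := hT
  let B := Metric.closedBall D.center D.radius
  let l : ℂ → ℂ := fun z => Complex.log a + D.log (a⁻¹ * z)
  have hTB : spectrum ℂ T ⊆ B := D.spectrum_subset_ball.trans Metric.ball_subset_closedBall
  have hl : ContinuousOn l (a • B) := continuousOn_const.add <|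
    D.log_continuousOn.comp (by fun_prop) <| by
      rintro - ⟨z, hz, rfl⟩
      simpa only [smul_eq_mul, inv_mul_cancel_left₀ ha] using hz
  have hexp : ∀ z ∈ a • B, Complex.exp (l z) = z := by
    rintro - ⟨z, hz, rfl⟩
    simp only [l, smul_eq_mul, inv_mul_cancel_left₀ ha]
    rw [Complex.exp_add, Complex.exp_log ha, D.exp_log z hz]
  have hspec : spectrum ℂ (a • T) ⊆ a • B := by
    rw [← cfc_const_mul_id a T, cfc_map_spectrum (fun z => a * z) T]
    exact Set.image_mono hTB
  have hcfc : cfc l (a • T) = Complex.log a • 1 + cfc D.log T := by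
    rw [← cfc_comp_const_mul a l T (hl.mono (Set.image_mono hTB))]
    simp only [l, inv_mul_cancel_left₀ ha]
    rw [cfc_const_add _ _ T (D.log_continuousOn.mono hTB), Algebra.algebraMap_eq_smul_one]
  have hconv : Convex ℝ (a • B) := by
    rw [smul_closedBall a _ D.radius_pos.le]
    exact convex_closedBall _ _
  rw [analyticDet_eq_exp_cfc τ hτ ((isCompact_closedBall _ _).smul a) hconv hspec hl hexp, hcfc,
    analyticDet_eq_exp_cfc τ hτ (isCompact_closedBall _ _) (convex_closedBall _ _) hTB
      D.log_continuousOn D.exp_log,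
    map_add, map_smul, hτ, smul_eq_mul, Complex.exp_add, mul_comm _ (n : ℂ), Complex.exp_nat_mul,
    Complex.exp_log ha]

theorem LogData.norm_sub_center_lt {T : H →L[ℂ] H} [IsStarNormal T] (D : LogData T) :
    ‖T - D.center • 1‖ < ‖D.center‖ := by
  have hr : D.radius < ‖D.center‖ := by
    by_contra! h
    exact Complex.exp_ne_zero _ (D.exp_log 0 (by rwa [mem_closedBall_iff_norm, zero_sub, norm_neg]))
  rw [← cfc_sub_const_eq]
  exact (norm_cfc_le D.radius_pos.le fun z hz =>
    (mem_ball_iff_norm.1 (D.spectrum_subset_ball hz)).le).trans_lt hr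

theorem analyticDet_eq_exp_sub_tsum (hτ : τ 1 = n) {T : H →L[ℂ] H} [IsStarNormal T] {c : ℂ}
    (hTc : ‖T - c • 1‖ < ‖c‖) :
    analyticDet τ T =
      Complex.exp (n * Complex.log c - ∑' k : ℕ, τ ((1 - c⁻¹ • T) ^ k) / k) := by
  have hc : c ≠ 0 := norm_pos_iff.1 ((norm_nonneg _).trans_lt hTc)
  have hslit : ∀ z ∈ Metric.closedBall c ‖T - c • 1‖, z / c ∈ Complex.slitPlane := fun z hz =>
    div_mem_slitPlane ((mem_closedBall_iff_norm.1 hz).trans_lt hTc)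
  have hlog : ContinuousOn (fun z => Complex.log (z / c)) (Metric.closedBall c ‖T - c • 1‖) :=
    (continuousOn_id.div_const c).clog hslit
  have hcont : ContinuousOn (fun z => Complex.log c + Complex.log (z / c))
      (Metric.closedBall c ‖T - c • 1‖) := continuousOn_const.add hlog
  have hexp : ∀ z ∈ Metric.closedBall c ‖T - c • 1‖,
      Complex.exp (Complex.log c + Complex.log (z / c)) = z := fun z hz => by
    rw [Complex.exp_add, Complex.exp_log hc, Complex.exp_log
      (Complex.slitPlane_ne_zero (hslit z hz)), mul_div_cancel₀ _ hc]
  have hsum : ∑' k : ℕ, τ ((1 - c⁻¹ • T) ^ k) / k = -τ (cfc (fun z => Complex.log (z / c)) T) := by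
    simpa only [map_smul, map_neg, smul_eq_mul, ← div_eq_inv_mul] using
      (τ.hasSum (hasSum_neg_cfc_log_div T hTc)).tsum_eq
  rw [analyticDet_eq_exp_cfc τ hτ (isCompact_closedBall _ _) (convex_closedBall _ _)
      (spectrum_subset_closedBall T c) hcont hexp,
    cfc_const_add _ _ T (hlog.mono (spectrum_subset_closedBall T c)), hsum,
    Algebra.algebraMap_eq_smul_one, map_add, map_smul, hτ, smul_eq_mul, sub_neg_eq_add,
    mul_comm (n : ℂ)]

theorem differentiableOn_tsum_apply_pow_div {S : ℂ → (H →L[ℂ] H)} (hS : Differentiable ℂ S)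
    {U : Set ℂ} (hU : IsOpen U) {ρ : ℝ} (hρ : ρ ∈ Set.Ico 0 1) (hbound : ∀ u ∈ U, ‖S u‖ ≤ ρ) :
    DifferentiableOn ℂ (fun u => ∑' k : ℕ, τ (S u ^ k) / k) U := by
  refine Complex.differentiableOn_tsum_of_summable_norm
    ((summable_geometric_of_lt_one hρ.1 hρ.2).mul_left ‖τ‖) (fun k => ?_) hU fun k u hu => ?_
  · exact ((τ.differentiable.comp (hS.pow k)).div_const _).differentiableOn
  · calc ‖τ (S u ^ k) / k‖ ≤ ‖τ (S u ^ k)‖ := norm_div_natCast_le _ k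
      _ ≤ ‖τ‖ * ‖S u‖ ^ k := τ.le_opNorm_of_le (norm_pow_le_pow_norm _ k)
      _ ≤ ‖τ‖ * ρ ^ k := by
          gcongr
          exact hbound u hu

theorem differentiableAt_analyticDet (hτ : τ 1 = n) {T : ℂ → (H →L[ℂ] H)}
    (hT : Differentiable ℂ T) (hnormal : ∀ u, IsStarNormal (T u)) {u₀ : ℂ}
    (h₀ : Nonempty (LogData (T u₀))) :
    DifferentiableAt ℂ (fun u => analyticDet τ (T u)) u₀ := by
  obtain ⟨D⟩ := h₀
  obtain ⟨r, hr₀, hr⟩ := exists_between D.norm_sub_center_lt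
  have hc : 0 < ‖D.center‖ := (norm_nonneg _).trans_lt D.norm_sub_center_lt
  let U : Set ℂ := {u | ‖T u - D.center • 1‖ < r}
  have hU : IsOpen U := isOpen_lt (hT.continuous.sub continuous_const).norm continuous_const
  have hbound : ∀ u ∈ U, ‖1 - D.center⁻¹ • T u‖ ≤ r / ‖D.center‖ := fun u hu => by
    have hfactor : 1 - D.center⁻¹ • T u = -(D.center⁻¹ • (T u - D.center • 1)) := by
      rw [smul_sub, inv_smul_smul₀ (norm_pos_iff.1 hc), neg_sub]
    rw [hfactor, norm_neg, norm_smul, norm_inv, div_eq_inv_mul]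
    gcongr
    exact (Set.mem_ofPred.1 hu).le
  have hseries := differentiableOn_tsum_apply_pow_div τ (S := fun u => 1 - D.center⁻¹ • T u)
    (by fun_prop) hU ⟨(norm_nonneg _).trans (hbound u₀ hr₀), (div_lt_one hc).2 hr⟩ hbound
  refine (((hseries.const_sub (n * Complex.log D.center)).cexp).congr fun u hu => ?_
    ).differentiableAt (hU.mem_nhds hr₀)
  have := hnormal u
  exact analyticDet_eq_exp_sub_tsum τ hτ ((Set.mem_ofPred.1 hu).trans hr)

end Determinant

/-! ### The adjacency operator and the deformed Laplacian -/

section AdjacencyOperator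

variable {V : Type*}

theorem regRep_apply {G : SimpleGraph V} (γ : G ≃g G) (f : L2 V) (x : V) :
    regRep γ f x = f (γ⁻¹ x) := rfl

open Classical in
/-- The trace `Tr_Γ` as a continuous linear functional. -/
def traceCLM (F : Finset V) : (L2 V →L[ℂ] L2 V) →L[ℂ] ℂ :=
  ∑ x ∈ F, lp.evalCLM ℂ (fun _ : V => ℂ) 2 x ∘L
    ContinuousLinearMap.apply ℂ (L2 V) (lp.single 2 x (1 : ℂ))

theorem coe_traceCLM (F : Finset V) : ⇑(traceCLM F) = trace F := by
  ext T
  simp only [traceCLM, trace, FunLike.coe_sum, Finset.sum_apply,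
    ContinuousLinearMap.comp_apply, ContinuousLinearMap.apply_apply]
  rfl

theorem traceCLM_one (F : Finset V) : traceCLM F 1 = F.card := by
  classical
  simp [coe_traceCLM, trace]

variable (G : SimpleGraph V) [G.LocallyFinite] (d : ℕ) (hd : ∀ v, G.degree v ≤ d)

theorem adjOp_apply (f : L2 V) (x : V) :
    adjOp G d hd f x = ∑ y ∈ G.neighborFinset x, f y := rfl

theorem norm_adjOp_le : ‖adjOp G d hd‖ ≤ d := by
  refine ContinuousLinearMap.opNorm_le_bound _ (Nat.cast_nonneg d) fun f => ?_
  refine abs_le_of_sq_le_sq' ?_ (by positivity) |>.2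
  have hbound := adj_bound G d hd f
  rw [enorm_sq_eq, ← ENNReal.ofReal_mul (sq_nonneg _)] at hbound
  rw [mul_pow]
  exact (ENNReal.ofReal_le_ofReal_iff (by positivity)).1
    ((enorm_sq_eq (adjOp G d hd f)).symm.le.trans hbound)

theorem adjOp_single [DecidableEq V] (x : V) :
    adjOp G d hd (lp.single 2 x (1 : ℂ)) = ∑ y ∈ G.neighborFinset x, lp.single 2 y (1 : ℂ) := by
  ext z
  rw [adjOp_apply]
  simp only [lp.coeFn_sum, Finset.sum_apply, lp.coeFn_single, Pi.single_apply,
    Finset.sum_ite_eq', Finset.sum_ite_eq]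
  exact if_congr (by simp only [SimpleGraph.mem_neighborFinset, G.adj_comm]) rfl rfl

theorem adjOp_isSelfAdjoint : IsSelfAdjoint (adjOp G d hd) := by
  classical
  have hcoord : ∀ (g : L2 V) (y : V), g y = inner ℂ (lp.single 2 y (1 : ℂ)) g := fun g y => by
    simp [lp.inner_single_left]
  rw [ContinuousLinearMap.isSelfAdjoint_iff']
  ext f x
  rw [hcoord, ContinuousLinearMap.adjoint_inner_right, adjOp_single, sum_inner, adjOp_apply]
  exact Finset.sum_congr rfl fun y _ => (hcoord f y).symm

instance isStarNormal_adjOp : IsStarNormal (adjOp G d hd) :=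
  (adjOp_isSelfAdjoint G d hd).isStarNormal

theorem spectrum_adjOp_subset :
    spectrum ℂ (adjOp G d hd) ⊆ (fun x : ℝ => (x : ℂ)) '' Set.Icc (-(d : ℝ)) d := by
  intro z hz
  have hz_re : z = z.re := (adjOp_isSelfAdjoint G d hd).mem_spectrum_eq_re hz
  have hz_norm : ‖z‖ ≤ d := calc
    ‖z‖ ≤ ‖adjOp G d hd‖ * ‖(1 : L2 V →L[ℂ] L2 V)‖ := spectrum.norm_le_norm_mul_of_mem hz
    _ ≤ ‖adjOp G d hd‖ :=
      mul_le_of_le_one_right (norm_nonneg _) ContinuousLinearMap.norm_id_le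
    _ ≤ d := norm_adjOp_le G d hd
  exact ⟨z.re, abs_le.1 ((Complex.abs_re_le_norm z).trans hz_norm), hz_re.symm⟩

theorem map_neighborFinset (γ : G ≃g G) (x : V) :
    (G.neighborFinset x).map γ.toEquiv.toEmbedding = G.neighborFinset (γ x) := by
  ext y
  rw [Finset.mem_map_equiv, SimpleGraph.mem_neighborFinset, SimpleGraph.mem_neighborFinset,
    ← γ.map_adj_iff]
  exact iff_of_eq (congrArg _ (γ.toEquiv.apply_symm_apply y))

theorem adjOp_mem_groupAlg (Γ : Subgroup (G ≃g G)) : adjOp G d hd ∈ groupAlg Γ := by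
  rw [groupAlg, Subalgebra.mem_centralizer_iff]
  rintro _ ⟨γ, -, rfl⟩
  ext f x
  change regRep γ (adjOp G d hd f) x = adjOp G d hd (regRep γ f) x
  simp only [regRep_apply, adjOp_apply]
  rw [← map_neighborFinset, Finset.sum_map]
  rfl

end AdjacencyOperator

section Symbol

/-- The function `x ↦ 1 + q u² - u x` whose value at the adjacency operator is `Δ(u)`. -/
def symbol (q : ℕ) (u x : ℂ) : ℂ := 1 + q * u ^ 2 - u * x

/-- The interval `[-(q + 1), q + 1]`, which contains the spectrum of the adjacency operator of a
`(q + 1)`-regular graph. -/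
def degreeInterval (q : ℕ) : Set ℝ := Set.Icc (-((q + 1 : ℕ) : ℝ)) ((q + 1 : ℕ) : ℝ)

variable {q : ℕ} {u : ℂ}

theorem mem_degreeInterval_iff {x : ℝ} : x ∈ degreeInterval q ↔ |x| ≤ q + 1 := by
  rw [degreeInterval, Set.mem_Icc, ← abs_le, Nat.cast_succ]

theorem continuous_symbol (q : ℕ) (u : ℂ) : Continuous (symbol q u) := by
  unfold symbol; fun_prop

theorem isCompact_symbol_image (q : ℕ) (u : ℂ) :
    IsCompact ((fun x : ℝ => symbol q u x) '' degreeInterval q) :=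
  isCompact_Icc.image ((continuous_symbol q u).comp Complex.continuous_ofReal)

theorem convex_symbol_image (q : ℕ) (u : ℂ) :
    Convex ℝ ((fun x : ℝ => symbol q u x) '' degreeInterval q) := by
  rintro - ⟨x, hx, rfl⟩ - ⟨y, hy, rfl⟩ s t hs ht hst
  refine ⟨s • x + t • y, convex_Icc _ _ hx hy hs ht hst, ?_⟩
  have hst' : (s : ℂ) + t = 1 := by exact_mod_cast hst
  simp only [symbol, smul_eq_mul, Complex.real_smul]
  push_cast
  linear_combination (-(1 + q * u ^ 2)) * hst'

theorem symbol_one_div (hq : 1 ≤ q) (hu : u ≠ 0) (x : ℂ) :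
    symbol q (1 / (q * u)) x = (q * u ^ 2)⁻¹ * symbol q u x := by
  have hq' : (q : ℂ) ≠ 0 := Nat.cast_ne_zero.2 (by lia)
  unfold symbol
  field_simp
  ring

theorem symbol_re (q : ℕ) (u : ℂ) (x : ℝ) :
    (symbol q u x).re = 1 + q * (u.re ^ 2 - u.im ^ 2) - u.re * x := by
  simp [symbol, pow_two]

theorem symbol_im (q : ℕ) (u : ℂ) (x : ℝ) :
    (symbol q u x).im = u.im * (2 * q * u.re - x) := by
  simp [symbol, pow_two]
  ring

theorem one_add_mul_sq_le_iff (hq : 1 ≤ q) {r : ℝ} (hr : 0 ≤ r) :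
    1 + q * r ^ 2 ≤ (q + 1) * r ↔ 1 / (q : ℝ) ≤ r ∧ r ≤ 1 := by
  have hq' : (1 : ℝ) ≤ q := by exact_mod_cast hq
  have hfactor : 1 + q * r ^ 2 - (q + 1) * r = (q * r - 1) * (r - 1) := by ring
  rw [← sub_nonpos, hfactor, div_le_iff₀ (by positivity), mul_comm r]
  have hmul : r ≤ q * r := le_mul_of_one_le_left hr hq'
  constructor
  · intro h
    constructor <;> by_contra! hlt
    · exact h.not_gt (mul_pos_of_neg_of_neg (by linarith) (by linarith))
    · exact h.not_gt (mul_pos (by linarith) (by linarith))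
  · rintro ⟨hlow, hhigh⟩
    exact mul_nonpos_of_nonneg_of_nonpos (by linarith) (by linarith)

theorem exists_symbol_eq_zero_iff_of_im_eq_zero (hq : 1 ≤ q) (hu : u.im = 0) :
    (∃ x ∈ degreeInterval q, symbol q u x = 0) ↔ 1 / (q : ℝ) ≤ |u.re| ∧ |u.re| ≤ 1 := by
  have hzero (x : ℝ) : symbol q u x = 0 ↔ 1 + q * |u.re| ^ 2 = u.re * x := by
    rw [Complex.ext_iff, symbol_re, symbol_im, hu, sq_abs, ← sub_eq_zero (b := u.re * x)]
    simp
  simp only [hzero, mem_degreeInterval_iff, ← one_add_mul_sq_le_iff hq (abs_nonneg u.re)]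
  constructor
  · rintro ⟨x, hx, h⟩
    calc 1 + q * |u.re| ^ 2 ≤ |u.re * x| := h.le.trans (le_abs_self _)
      _ = |x| * |u.re| := by rw [abs_mul, mul_comm]
      _ ≤ (q + 1) * |u.re| := by gcongr
  · intro h
    have hre : 0 < |u.re| := by
      by_contra! hle
      nlinarith [sq_nonneg |u.re|, (Nat.cast_nonneg q : (0 : ℝ) ≤ q)]
    refine ⟨(1 + q * |u.re| ^ 2) / u.re, ?_, (mul_div_cancel₀ _ (abs_pos.1 hre)).symm⟩
    rwa [abs_div, abs_of_nonneg (a := 1 + _) (by positivity), div_le_iff₀ hre]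

theorem exists_symbol_eq_zero_iff_of_im_ne_zero (hq : 1 ≤ q) (hu : u.im ≠ 0) :
    (∃ x ∈ degreeInterval q, symbol q u x = 0) ↔ u.re ^ 2 + u.im ^ 2 = 1 / (q : ℝ) := by
  have hq' : (0 : ℝ) < q := by exact_mod_cast hq
  have hzero (x : ℝ) : symbol q u x = 0 ↔ x = 2 * q * u.re ∧ (u.re ^ 2 + u.im ^ 2) * q = 1 := by
    rw [Complex.ext_iff, symbol_re, symbol_im, Complex.zero_re, Complex.zero_im, mul_eq_zero,
      or_iff_right hu]
    constructor
    · rintro ⟨hre, him⟩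
      obtain rfl : x = 2 * q * u.re := by linarith
      exact ⟨rfl, by linarith⟩
    · rintro ⟨rfl, hcircle⟩
      exact ⟨by linarith, sub_self _⟩
  rw [eq_div_iff hq'.ne']
  simp only [hzero, mem_degreeInterval_iff]
  refine ⟨fun ⟨_, _, _, hcircle⟩ => hcircle, fun hcircle => ⟨_, ?_, rfl, hcircle⟩⟩
  refine abs_le_of_sq_le_sq ?_ (by positivity)
  calc (2 * q * u.re) ^ 2 = 4 * q * (1 - q * u.im ^ 2 : ℝ) := by linear_combination 4 * q * hcircle
    _ ≤ 4 * q * (1 : ℝ) := by gcongr; exact sub_le_self 1 (by positivity)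
    _ ≤ (q + 1 : ℝ) ^ 2 := by linarith [sq_nonneg ((q : ℝ) - 1)]

theorem mem_holomorphyDomain_iff (hq : 1 ≤ q) :
    u ∈ holomorphyDomain q ↔ ∀ x ∈ degreeInterval q, symbol q u x ≠ 0 := by
  have hq' : (1 : ℝ) ≤ q := by exact_mod_cast hq
  have hcompl : u ∈ holomorphyDomain q ↔ ¬ ∃ x ∈ degreeInterval q, symbol q u x = 0 := by
    refine not_congr ?_
    simp only [Set.mem_union, Set.mem_ofPred_eq]
    by_cases hu : u.im = 0
    · rw [exists_symbol_eq_zero_iff_of_im_eq_zero hq hu, hu, and_iff_right rfl, or_iff_right_of_imp]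
      intro hcircle
      rw [← one_add_mul_sq_le_iff hq (abs_nonneg _), sq_abs]
      have hre : u.re ^ 2 * q = 1 := by rw [← eq_div_iff (by positivity)]; linarith
      have hone : 1 ≤ q * |u.re| := by
        refine (one_le_sq_iff₀ (by positivity)).1 ?_
        rw [mul_pow, sq_abs]
        nlinarith
      nlinarith [sq_abs u.re, abs_nonneg u.re]
    · rw [exists_symbol_eq_zero_iff_of_im_ne_zero hq hu]
      simp only [hu, false_and, or_false]
  simpa only [not_exists, not_and] using hcompl

theorem zero_notMem_symbol_image (hq : 1 ≤ q) (hu : u ∈ holomorphyDomain q) :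
    0 ∉ (fun x : ℝ => symbol q u x) '' degreeInterval q := by
  rintro ⟨x, hx, hzero⟩
  exact (mem_holomorphyDomain_iff hq).1 hu x hx hzero

theorem isOpen_holomorphyDomain (q : ℕ) : IsOpen (holomorphyDomain q) := by
  have hcircle : IsClosed {u : ℂ | u.re ^ 2 + u.im ^ 2 = 1 / (q : ℝ)} :=
    isClosed_eq (by fun_prop) continuous_const
  have hsegments : IsClosed {u : ℂ | u.im = 0 ∧ 1 / (q : ℝ) ≤ |u.re| ∧ |u.re| ≤ 1} :=
    (isClosed_eq Complex.continuous_im continuous_const).inter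
      ((isClosed_le continuous_const Complex.continuous_re.abs).inter
        (isClosed_le Complex.continuous_re.abs continuous_const))
  exact (hcircle.union hsegments).isOpen_compl

theorem ball_subset_holomorphyDomain (hq : 1 ≤ q) :
    Metric.ball (0 : ℂ) (1 / (q : ℝ)) ⊆ holomorphyDomain q := by
  intro u hu
  rw [mem_ball_zero_iff] at hu
  have hq' : (1 : ℝ) ≤ q := by exact_mod_cast hq
  rintro (hcircle | ⟨-, hre, -⟩)
  · have hnorm_sq : ‖u‖ ^ 2 = 1 / q := by
      rw [← Complex.normSq_eq_norm_sq, Complex.normSq_apply, ← hcircle]; ring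
    have hnorm : ‖u‖ < 1 := hu.trans_le ((div_le_one (by positivity)).2 hq')
    nlinarith [norm_nonneg u]
  · exact absurd (hre.trans (Complex.abs_re_le_norm u)) (not_le.2 hu)

theorem one_div_mem_holomorphyDomain (hq : 1 ≤ q) (hu : u ∈ holomorphyDomain q) (hu0 : u ≠ 0) :
    1 / ((q : ℂ) * u) ∈ holomorphyDomain q := by
  have hq' : (q : ℂ) ≠ 0 := Nat.cast_ne_zero.2 (by lia)
  rw [mem_holomorphyDomain_iff hq] at hu ⊢
  intro x hx
  rw [symbol_one_div hq hu0]
  exact mul_ne_zero (by positivity) (hu x hx)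

theorem one_sub_sq_ne_zero_of_mem_holomorphyDomain (hq : 1 ≤ q) (hu : u ∈ holomorphyDomain q) :
    1 - u ^ 2 ≠ 0 := by
  have hinv : (q : ℝ)⁻¹ ≤ 1 := inv_le_one_of_one_le₀ (by exact_mod_cast hq)
  intro hzero
  rcases sq_eq_one_iff.1 (sub_eq_zero.1 hzero).symm with rfl | rfl <;>
    exact hu (Or.inr (by simpa using hinv))

end Symbol

section DeformedLaplacian

variable {V : Type*} (G : SimpleGraph V) [G.LocallyFinite] {q : ℕ}
  (hG : G.IsRegularOfDegree (q + 1))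

/-- The adjacency operator of a `(q + 1)`-regular graph. -/
abbrev regularAdjOp : L2 V →L[ℂ] L2 V := adjOp G (q + 1) fun v => (hG v).le

theorem deformedLaplacian_eq_cfc (u : ℂ) :
    deformedLaplacian G q hG u = cfc (symbol q u) (regularAdjOp G hG) := by
  unfold symbol
  rw [cfc_sub _ _ _ continuousOn_const (by fun_prop), cfc_const _ _,
    cfc_const_mul_id u _, Algebra.algebraMap_eq_smul_one]
  rfl

theorem deformedLaplacian_zero : deformedLaplacian G q hG 0 = 1 := by
  simp [deformedLaplacian]

instance isStarNormal_deformedLaplacian (u : ℂ) : IsStarNormal (deformedLaplacian G q hG u) := by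
  rw [deformedLaplacian_eq_cfc]
  exact cfc_predicate _ _

theorem deformedLaplacian_mem_groupAlg (u : ℂ) (Γ : Subgroup (G ≃g G)) :
    deformedLaplacian G q hG u ∈ groupAlg Γ :=
  (groupAlg Γ).sub_mem ((groupAlg Γ).smul_mem (groupAlg Γ).one_mem _)
    ((groupAlg Γ).smul_mem (adjOp_mem_groupAlg G _ _ Γ) u)

theorem deformedLaplacian_one_div (hq : 1 ≤ q) {u : ℂ} (hu : u ≠ 0) :
    deformedLaplacian G q hG (1 / (q * u)) = (q * u ^ 2)⁻¹ • deformedLaplacian G q hG u := by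
  rw [deformedLaplacian_eq_cfc, deformedLaplacian_eq_cfc,
    ← cfc_smul _ _ _ (continuous_symbol q u).continuousOn]
  exact cfc_congr fun x _ => symbol_one_div hq hu x

theorem spectrum_deformedLaplacian_subset (u : ℂ) :
    spectrum ℂ (deformedLaplacian G q hG u) ⊆ (fun x : ℝ => symbol q u x) '' degreeInterval q := by
  rw [deformedLaplacian_eq_cfc, cfc_map_spectrum (symbol q u) _
    (hf := (continuous_symbol q u).continuousOn)]
  refine (Set.image_mono (spectrum_adjOp_subset G _ _)).trans_eq ?_
  rw [Set.image_image]
  rfl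

variable {u : ℂ}

theorem zero_notMem_convexHull_spectrum (hq : 1 ≤ q) (hu : u ∈ holomorphyDomain q) :
    0 ∉ convexHull ℝ (spectrum ℂ (deformedLaplacian G q hG u)) := fun h =>
  zero_notMem_symbol_image hq hu
    (convexHull_min (spectrum_deformedLaplacian_subset G hG u) (convex_symbol_image q u) h)

theorem nonempty_logData_deformedLaplacian (hq : 1 ≤ q) (hu : u ∈ holomorphyDomain q) :
    Nonempty (LogData (deformedLaplacian G q hG u)) :=
  nonempty_logData (isCompact_symbol_image q u) (convex_symbol_image q u)
    (zero_notMem_symbol_image hq hu) (spectrum_deformedLaplacian_subset G hG u)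

theorem differentiable_deformedLaplacian : Differentiable ℂ (deformedLaplacian G q hG) := by
  unfold deformedLaplacian
  fun_prop

variable (F : Finset V)

theorem differentiableOn_zeta_extension (hq : 1 ≤ q) (χ : ℤ) :
    DifferentiableOn ℂ (fun u => (1 - u ^ 2) ^ χ *
      (analyticDet (trace F) (deformedLaplacian G q hG u))⁻¹) (holomorphyDomain q) := by
  intro u hu
  have hlog := nonempty_logData_deformedLaplacian G hG hq hu
  have hdet := differentiableAt_analyticDet (traceCLM F) (traceCLM_one F)
    (differentiable_deformedLaplacian G hG) (fun _ => inferInstance) hlog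
  rw [coe_traceCLM] at hdet
  have hpow : DifferentiableAt ℂ (fun u : ℂ => (1 - u ^ 2) ^ χ) u :=
    DifferentiableAt.zpow (by fun_prop) (Or.inl (one_sub_sq_ne_zero_of_mem_holomorphyDomain hq hu))
  exact (hpow.mul (hdet.inv (analyticDet_ne_zero _ hlog))).differentiableWithinAt

theorem analyticDet_functional_equation (hq : 1 ≤ q) (hu : u ∈ holomorphyDomain q) (hu0 : u ≠ 0) :
    analyticDet (trace F) (deformedLaplacian G q hG (1 / (q * u))) =
      (q * u ^ 2) ^ (-(F.card : ℤ)) * analyticDet (trace F) (deformedLaplacian G q hG u) := by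
  have hq' : (q : ℂ) ≠ 0 := Nat.cast_ne_zero.2 (by lia)
  rw [deformedLaplacian_one_div G hG hq hu0, ← coe_traceCLM,
    analyticDet_smul (traceCLM F) (traceCLM_one F)
      (nonempty_logData_deformedLaplacian G hG hq hu) (by positivity),
    inv_pow, zpow_neg, zpow_natCast]

end DeformedLaplacian

section PowerSums

open Polynomial

theorem eval_add_dickson_one_mul {R : Type*} [CommRing R] (a b : R) (m : ℕ) :
    (dickson 1 (a * b) m).eval (a + b) = a ^ m + b ^ m := by
  induction m using Nat.twoStepInduction with
  | zero => norm_num [dickson_zero]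
  | one => simp [dickson_one]
  | more m ih ih' =>
    rw [dickson_add_two, eval_sub, eval_mul, eval_mul, eval_X, eval_C, ih, ih']
    ring

variable {q : ℕ}

theorem norm_le_of_root (hq : 1 ≤ q) {x : ℝ} (hx : x ∈ degreeInterval q) {a : ℂ}
    (ha : a ^ 2 - x * a + q = 0) : ‖a‖ ≤ q := by
  have hq' : (0 : ℝ) < q := by exact_mod_cast hq
  by_contra! hlt
  have ha0 : a ≠ 0 := norm_pos_iff.1 (hq'.trans hlt)
  have hball : a⁻¹ ∈ Metric.ball (0 : ℂ) (1 / (q : ℝ)) := by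
    rw [mem_ball_zero_iff, norm_inv, one_div]
    exact inv_strictAnti₀ hq' hlt
  refine (mem_holomorphyDomain_iff hq).1 (ball_subset_holomorphyDomain hq hball) x hx ?_
  unfold symbol
  field_simp
  linear_combination ha

theorem exists_roots (hq : 1 ≤ q) {x : ℝ} (hx : x ∈ degreeInterval q) :
    ∃ a b : ℂ, a + b = x ∧ a * b = q ∧ ‖a‖ ≤ q ∧ ‖b‖ ≤ q := by
  obtain ⟨s, hs⟩ := IsAlgClosed.exists_pow_nat_eq ((x : ℂ) ^ 2 - 4 * q) (n := 2) two_pos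
  refine ⟨(x + s) / 2, (x - s) / 2, by ring, by linear_combination (-1 / 4) * hs,
    norm_le_of_root hq hx ?_, norm_le_of_root hq hx ?_⟩ <;>
    linear_combination (1 / 4) * hs

theorem norm_eval_dickson_mul_pow_div_le (hq : 1 ≤ q) (u : ℂ) {x : ℝ} (hx : x ∈ degreeInterval q)
    (m : ℕ) : ‖(dickson 1 (q : ℂ) m).eval (x : ℂ) * u ^ m / m‖ ≤ 2 * (q * ‖u‖) ^ m := by
  obtain ⟨a, b, hadd, hmul, ha, hb⟩ := exists_roots hq hx
  have hsum : ‖a ^ m + b ^ m‖ ≤ 2 * (q : ℝ) ^ m := by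
    refine (norm_add_le _ _).trans ?_
    rw [norm_pow, norm_pow, two_mul]
    gcongr
  refine (norm_div_natCast_le _ m).trans ?_
  rw [← hadd, ← hmul, eval_add_dickson_one_mul, norm_mul, norm_pow, mul_pow, ← mul_assoc]
  gcongr

/-- The power series `∑ (αᵐ + βᵐ) uᵐ / m` of `-log ((1 - α u) (1 - β u))`, where `α + β = x` and
`α β = q`, so that `(1 - α u) (1 - β u) = 1 + q u² - u x`. -/
def negLogSymbol (q : ℕ) (u x : ℂ) : ℂ := ∑' m : ℕ, (dickson 1 (q : ℂ) m).eval x * u ^ m / m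

theorem exp_neg_negLogSymbol (hq : 1 ≤ q) {u : ℂ} (hu : q * ‖u‖ < 1) {x : ℝ}
    (hx : x ∈ degreeInterval q) : Complex.exp (-negLogSymbol q u x) = symbol q u x := by
  obtain ⟨a, b, hadd, hmul, ha, hb⟩ := exists_roots hq hx
  have hlt : ∀ c : ℂ, ‖c‖ ≤ q → ‖c * u‖ < 1 := fun c hc => by
    rw [norm_mul]
    exact (mul_le_mul_of_nonneg_right hc (norm_nonneg u)).trans_lt hu
  have hne : ∀ c : ℂ, ‖c‖ ≤ q → 1 - c * u ≠ 0 := fun c hc hzero => by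
    simpa [← sub_eq_zero.1 hzero] using hlt c hc
  have hlog : HasSum (fun m : ℕ => (dickson 1 (q : ℂ) m).eval (x : ℂ) * u ^ m / m)
      (-Complex.log (1 - a * u) + -Complex.log (1 - b * u)) := by
    refine ((Complex.hasSum_taylorSeries_neg_log (hlt a ha)).add
      (Complex.hasSum_taylorSeries_neg_log (hlt b hb))).congr_fun fun m => ?_
    rw [← hadd, ← hmul, eval_add_dickson_one_mul]
    ring
  rw [negLogSymbol, hlog.tsum_eq, neg_add, neg_neg, neg_neg, Complex.exp_add,
    Complex.exp_log (hne a ha), Complex.exp_log (hne b hb), symbol]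
  linear_combination (-u) * hadd + u ^ 2 * hmul

theorem summable_two_mul_pow {u : ℂ} (hu : q * ‖u‖ < 1) :
    Summable fun m : ℕ => 2 * (q * ‖u‖) ^ m :=
  (summable_geometric_of_lt_one (by positivity) hu).mul_left 2

theorem continuousOn_negLogSymbol (hq : 1 ≤ q) {u : ℂ} (hu : q * ‖u‖ < 1) :
    ContinuousOn (negLogSymbol q u) ((fun x : ℝ => (x : ℂ)) '' degreeInterval q) := by
  refine continuousOn_tsum (fun m => by fun_prop) (summable_two_mul_pow hu) ?_
  rintro m - ⟨x, hx, rfl⟩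
  exact norm_eval_dickson_mul_pow_div_le hq u hx m

variable {V : Type*} (G : SimpleGraph V) [G.LocallyFinite] (hG : G.IsRegularOfDegree (q + 1))

theorem hasSum_aeval_dickson (hq : 1 ≤ q) {u : ℂ} (hu : q * ‖u‖ < 1) :
    HasSum (fun m : ℕ => (u ^ m / m) • aeval (regularAdjOp G hG) (dickson 1 (q : ℂ) m))
      (cfc (negLogSymbol q u) (regularAdjOp G hG)) := by
  refine (hasSum_cfc _ (fun m => ?_) (summable_two_mul_pow hu) fun m z hz => ?_).congr_fun
    fun m => ?_
  · fun_prop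
  · obtain ⟨x, hx, rfl⟩ := spectrum_adjOp_subset G _ _ hz
    exact norm_eval_dickson_mul_pow_div_le hq u hx m
  · rw [← cfc_polynomial _ (regularAdjOp G hG), ← cfc_smul _ _ _ (by fun_prop)]
    exact cfc_congr fun x _ => by rw [smul_eq_mul, mul_comm, mul_div_assoc]

theorem analyticDet_deformedLaplacian (hq : 1 ≤ q) (F : Finset V) {u : ℂ} (hu : q * ‖u‖ < 1) :
    analyticDet (traceCLM F) (deformedLaplacian G q hG u) =
      Complex.exp (-traceCLM F (cfc (negLogSymbol q u) (regularAdjOp G hG))) := by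
  rcases eq_or_ne u 0 with rfl | hu0
  · have hzero : negLogSymbol q 0 = fun _ => 0 := funext fun x => by
      refine (tsum_congr fun m => ?_).trans tsum_zero
      rcases m.eq_zero_or_pos with rfl | hm
      · rw [Nat.cast_zero, div_zero]
      · rw [zero_pow hm.ne', mul_zero, zero_div]
    rw [deformedLaplacian_zero, analyticDet_one _ (traceCLM_one F), hzero, cfc_const_zero, map_zero,
      neg_zero, Complex.exp_zero]
  let solve : ℂ → ℂ := fun z => (1 + q * u ^ 2 - z) / u
  have hsolve : ∀ x, solve (symbol q u x) = x := fun x => by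
    simp only [solve, symbol, sub_sub_cancel]
    exact mul_div_cancel_left₀ x hu0
  have hcont : ContinuousOn (fun z => -negLogSymbol q u (solve z))
      ((fun x : ℝ => symbol q u x) '' degreeInterval q) := by
    refine ((continuousOn_negLogSymbol hq hu).comp (by fun_prop) ?_).neg
    rintro - ⟨x, hx, rfl⟩
    exact ⟨x, hx, (hsolve x).symm⟩
  rw [analyticDet_eq_exp_cfc _ (traceCLM_one F) (isCompact_symbol_image q u)
    (convex_symbol_image q u) (spectrum_deformedLaplacian_subset G hG u) hcont ?_]
  · have himage : symbol q u '' spectrum ℂ (regularAdjOp G hG) ⊆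
        (fun x : ℝ => symbol q u x) '' degreeInterval q := by
      rintro - ⟨z, hz, rfl⟩
      obtain ⟨x, hx, rfl⟩ := spectrum_adjOp_subset G _ _ hz
      exact ⟨x, hx, rfl⟩
    rw [deformedLaplacian_eq_cfc, ← cfc_comp' _ _ _ (hcont.mono himage)
      (continuous_symbol q u).continuousOn]
    simp only [hsolve, cfc_neg, map_neg]
  · rintro - ⟨x, hx, rfl⟩
    rw [hsolve]
    exact exp_neg_negLogSymbol hq hu hx

theorem exists_hasSum_trace_dickson (hq : 1 ≤ q) (F : Finset V) {u : ℂ} (hu : ‖u‖ < 1 / (q : ℝ)) :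
    ∃ W : ℂ,
      HasSum
        (fun m : ℕ => trace F (aeval (regularAdjOp G hG) (dickson 1 (q : ℂ) m)) * u ^ m / m) W ∧
        analyticDet (trace F) (deformedLaplacian G q hG u) = Complex.exp (-W) := by
  have hq' : (0 : ℝ) < q := by exact_mod_cast hq
  rw [lt_div_iff₀' hq'] at hu
  rw [← coe_traceCLM, analyticDet_deformedLaplacian G hG hq F hu]
  refine ⟨_, ((traceCLM F).hasSum (hasSum_aeval_dickson G hG hq hu)).congr_fun fun m => ?_, rfl⟩
  rw [map_smul, smul_eq_mul]
  ring

end PowerSums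

/-! ### Oriented edges, chains and the edge operator -/

section FreeAction

variable {V : Type*} {G : SimpleGraph V} {Γ : Subgroup (G ≃g G)} {F : Finset V}

theorem ActsFreely.eq_of_apply_eq (hfree : ActsFreely Γ) {γ δ : G ≃g G} (hγ : γ ∈ Γ) (hδ : δ ∈ Γ)
    {x : V} (hx : γ x = δ x) : γ = δ := by
  by_contra hne
  refine (hfree (δ⁻¹ * γ) (Γ.mul_mem (Γ.inv_mem hδ) hγ) fun hone => hne ?_).1 x ?_
  · rwa [inv_mul_eq_one, eq_comm] at hone
  · rw [RelIso.mul_apply, hx, RelIso.inv_apply_self]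

theorem IsRepresentatives.exists_apply_mem (hF : IsRepresentatives Γ F) (x : V) :
    ∃ γ ∈ Γ, γ x ∈ F := by
  obtain ⟨y, ⟨hy, γ, hγ, rfl⟩, -⟩ := hF x
  exact ⟨γ, hγ, hy⟩

theorem IsRepresentatives.eq_of_apply_mem (hfree : ActsFreely Γ) (hF : IsRepresentatives Γ F)
    {γ δ : G ≃g G} (hγ : γ ∈ Γ) (hδ : δ ∈ Γ) {x : V} (hγx : γ x ∈ F) (hδx : δ x ∈ F) : γ = δ :=
  hfree.eq_of_apply_eq hγ hδ ((hF x).unique ⟨hγx, γ, hγ, rfl⟩ ⟨hδx, δ, hδ, rfl⟩)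

/-- An element of `Γ` that carries `x` into the set of representatives; it is unique if `Γ` acts
freely. -/
def carry (hF : IsRepresentatives Γ F) (x : V) : G ≃g G := (hF.exists_apply_mem x).choose

theorem carry_mem (hF : IsRepresentatives Γ F) (x : V) : carry hF x ∈ Γ :=
  (hF.exists_apply_mem x).choose_spec.1

theorem carry_apply_mem (hF : IsRepresentatives Γ F) (x : V) : carry hF x x ∈ F :=
  (hF.exists_apply_mem x).choose_spec.2

theorem carry_eq (hfree : ActsFreely Γ) (hF : IsRepresentatives Γ F) {γ : G ≃g G} (hγ : γ ∈ Γ)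
    {x : V} (hx : γ x ∈ F) : carry hF x = γ :=
  hF.eq_of_apply_mem hfree (carry_mem hF x) hγ (carry_apply_mem hF x) hx

end FreeAction

section Darts

variable {V : Type*} {G : SimpleGraph V}

/-- Graph automorphisms act on oriented edges. -/
instance : MulAction (G ≃g G) G.Dart where
  smul γ d := ⟨(γ d.fst, γ d.snd), γ.map_adj_iff.2 d.adj⟩
  one_smul _ := rfl
  mul_smul _ _ _ := rfl

theorem snd_smul (γ : G ≃g G) (d : G.Dart) : (γ • d).snd = γ d.snd := rfl

theorem symm_smul (γ : G ≃g G) (d : G.Dart) : (γ • d).symm = γ • d.symm := rfl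

variable [G.LocallyFinite]

/-- The oriented edges that start in `F`. -/
def dartsFrom (G : SimpleGraph V) [G.LocallyFinite] (F : Finset V) : Finset G.Dart :=
  (F.sigma fun _ => Finset.univ).map
    ⟨fun p : Σ x, G.neighborSet x => G.dartOfNeighborSet p.1 p.2, by
      rintro ⟨x, y, hy⟩ ⟨x', y', hy'⟩ h
      obtain ⟨rfl, rfl⟩ := Prod.ext_iff.1 (congrArg SimpleGraph.Dart.toProd h)
      rfl⟩

theorem mem_dartsFrom {F : Finset V} {d : G.Dart} : d ∈ dartsFrom G F ↔ d.fst ∈ F := by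
  simp only [dartsFrom, Finset.mem_map, Finset.mem_sigma, Finset.mem_univ, and_true]
  constructor
  · rintro ⟨p, hp, rfl⟩
    exact hp
  · exact fun hd => ⟨⟨d.fst, d.snd, d.adj⟩, hd, rfl⟩

theorem sum_dartsFrom {M : Type*} [AddCommMonoid M] (F : Finset V) (k : G.Dart → M) :
    ∑ d ∈ dartsFrom G F, k d = ∑ x ∈ F, ∑ d ∈ dartsFrom G {x}, k d := by
  simp only [dartsFrom, Finset.sum_map, Finset.sum_sigma, Finset.sum_singleton]

theorem sum_dartsFrom_singleton {M : Type*} [AddCommMonoid M] (x : V) (k : V → M) :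
    ∑ d ∈ dartsFrom G {x}, k d.snd = ∑ y ∈ G.neighborFinset x, k y := by
  rw [dartsFrom, Finset.sum_map, Finset.sum_sigma, Finset.sum_singleton,
    SimpleGraph.neighborFinset, ← Finset.sum_set_coe]
  rfl

theorem card_dartsFrom {d : ℕ} (hG : G.IsRegularOfDegree d) (F : Finset V) :
    (dartsFrom G F).card = F.card * d := by
  simp only [dartsFrom, Finset.card_map, Finset.card_sigma, Finset.card_univ,
    SimpleGraph.card_neighborSet_eq_degree, hG.degree_eq, Finset.sum_const, smul_eq_mul]

theorem sum_dartsFrom_symm {Γ : Subgroup (G ≃g G)} (hfree : ActsFreely Γ) {F : Finset V}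
    (hF : IsRepresentatives Γ F) {M : Type*} [AddCommMonoid M] (k : G.Dart → M)
    (hk : ∀ γ ∈ Γ, ∀ d, k (γ • d) = k d) :
    ∑ d ∈ dartsFrom G F, k d.symm = ∑ d ∈ dartsFrom G F, k d := by
  let reverse : G.Dart → G.Dart := fun d => carry hF d.snd • d.symm
  have hmem : ∀ d ∈ dartsFrom G F, reverse d ∈ dartsFrom G F := fun d _ =>
    mem_dartsFrom.2 (carry_apply_mem hF d.snd)
  have hreverse : ∀ d ∈ dartsFrom G F, reverse (reverse d) = d := fun d hd => by
    have hinv : carry hF (carry hF d.snd d.fst) = (carry hF d.snd)⁻¹ :=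
      carry_eq hfree hF (Γ.inv_mem (carry_mem hF _))
        (by rw [RelIso.inv_apply_self]; exact mem_dartsFrom.1 hd)
    change carry hF (carry hF d.snd d.fst) • carry hF d.snd • d.symm.symm = d
    rw [hinv, inv_smul_smul, SimpleGraph.Dart.symm_symm]
  exact Finset.sum_nbij' reverse reverse hmem hmem hreverse hreverse fun d _ =>
    (hk _ (carry_mem hF d.snd) d.symm).symm

end Darts

section Chains

variable {α β : Type*} {R : Type*} [CommSemiring R]

/-- The operator `f ↦ (x ↦ ∑_{y ∈ s x} f y)` of a relation given by the finite sets `s x` of the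
successors of `x`. -/
def sumOver (R : Type*) [CommSemiring R] (s : α → Finset β) : (β → R) →ₗ[R] (α → R) where
  toFun f x := ∑ y ∈ s x, f y
  map_add' _ _ := funext fun _ => Finset.sum_add_distrib
  map_smul' _ _ := funext fun _ => (Finset.mul_sum _ _ _).symm

theorem sumOver_apply (s : α → Finset β) (f : β → R) (x : α) :
    sumOver R s f x = ∑ y ∈ s x, f y := rfl

theorem sumOver_comp_equiv {s : α → Finset α} (e : α ≃ α)
    (hs : ∀ x, s (e x) = (s x).map e.toEmbedding) (f : α → R) :
    sumOver R s (f ∘ e) = sumOver R s f ∘ e := by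
  ext x
  simp only [sumOver_apply, Function.comp_apply, hs, Finset.sum_map, Equiv.coe_toEmbedding]

theorem sumOver_pow_comp_equiv {s : α → Finset α} (e : α ≃ α)
    (hs : ∀ x, s (e x) = (s x).map e.toEmbedding) (m : ℕ) (f : α → R) :
    (sumOver R s ^ m) (f ∘ e) = (sumOver R s ^ m) f ∘ e := by
  induction m with
  | zero => rfl
  | succ m ih => rw [pow_succ', Module.End.mul_apply, ih, sumOver_comp_equiv e hs]; rfl

/-- Chains `x = w₀, w₁, …, w_m = y` with `w_{i+1} ∈ s w_i`. They are encoded as sequences that stay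
at `y` from the index `m` on. -/
@[ext]
structure Chain (s : α → Finset α) (m : ℕ) (x y : α) where
  seq : ℕ → α
  seq_zero : seq 0 = x
  seq_succ_mem : ∀ i < m, seq (i + 1) ∈ s (seq i)
  seq_of_le : ∀ i, m ≤ i → seq i = y

instance (s : α → Finset α) (x y : α) : Subsingleton (Chain s 0 x y) :=
  ⟨fun w w' => Chain.ext <| funext fun i =>
    (w.seq_of_le i i.zero_le).trans (w'.seq_of_le i i.zero_le).symm⟩

/-- A chain with `m + 1` steps is determined by its second member and the remaining `m` steps. -/
def chainSuccEquiv (s : α → Finset α) (m : ℕ) (x y : α) :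
    Chain s (m + 1) x y ≃ Σ z : s x, Chain s m z y where
  toFun w :=
    ⟨⟨w.seq 1, by simpa only [w.seq_zero] using w.seq_succ_mem 0 m.succ_pos⟩,
      { seq := fun i => w.seq (i + 1)
        seq_zero := rfl
        seq_succ_mem := fun i hi => w.seq_succ_mem (i + 1) (Nat.succ_lt_succ hi)
        seq_of_le := fun i hi => w.seq_of_le (i + 1) (Nat.succ_le_succ hi) }⟩
  invFun p :=
    { seq := fun i => Nat.casesOn i x p.2.seq
      seq_zero := rfl
      seq_succ_mem := by
        rintro (_ | i) hi
        · change p.2.seq 0 ∈ s x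
          rw [p.2.seq_zero]
          exact p.1.2
        · exact p.2.seq_succ_mem i (Nat.lt_of_succ_lt_succ hi)
      seq_of_le := by
        rintro (_ | i) hi
        · exact absurd hi (Nat.not_succ_le_zero m)
        · exact p.2.seq_of_le i (Nat.le_of_succ_le_succ hi) }
  left_inv w := Chain.ext <| funext fun i => by
    cases i with
    | zero => exact w.seq_zero.symm
    | succ i => rfl
  right_inv p := by
    obtain ⟨⟨z, hz⟩, seq, hzero, hsucc, hle⟩ := p
    obtain rfl : seq 0 = z := hzero
    rfl

instance (s : α → Finset α) (m : ℕ) (x y : α) : Finite (Chain s m x y) := by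
  induction m generalizing x with
  | zero => infer_instance
  | succ m ih => exact Finite.of_equiv _ (chainSuccEquiv s m x y).symm

theorem card_chain [DecidableEq α] (s : α → Finset α) (m : ℕ) (x y : α) :
    (Nat.card (Chain s m x y) : R) = (sumOver R s ^ m) (Pi.single y 1) x := by
  induction m generalizing x with
  | zero =>
    rw [pow_zero, Module.End.one_apply]
    rcases eq_or_ne x y with rfl | hxy
    · have : Nonempty (Chain s 0 x x) :=
        ⟨⟨fun _ => x, rfl, fun _ hi => absurd hi (Nat.not_lt_zero _), fun _ _ => rfl⟩⟩
      rw [Nat.card_unique, Nat.cast_one, Pi.single_eq_same]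
    · have : IsEmpty (Chain s 0 x y) :=
        ⟨fun w => hxy (w.seq_zero.symm.trans (w.seq_of_le 0 le_rfl))⟩
      rw [Nat.card_of_isEmpty, Nat.cast_zero, Pi.single_eq_of_ne hxy]
  | succ m ih =>
    rw [Nat.card_congr (chainSuccEquiv s m x y), Nat.card_sigma, Nat.cast_sum, pow_succ',
      Module.End.mul_apply, sumOver_apply, ← Finset.sum_coe_sort (s x)]
    exact Finset.sum_congr rfl fun z _ => ih z

/-- Chains `x = w₀, w₁, …, w_m = x`, continued periodically. -/
@[ext]
structure PeriodicChain (s : α → Finset α) (m : ℕ) (x : α) where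
  seq : ℕ → α
  seq_zero : seq 0 = x
  seq_succ_mem : ∀ i, seq (i + 1) ∈ s (seq i)
  periodic : ∀ i, seq (i + m) = seq i

/-- A periodic chain is determined by its first period. -/
def periodicChainEquiv (s : α → Finset α) {m : ℕ} (hm : 0 < m) (x : α) :
    PeriodicChain s m x ≃ Chain s m x x where
  toFun w :=
    { seq := fun i => w.seq (min i m)
      seq_zero := by rw [Nat.zero_min, w.seq_zero]
      seq_succ_mem := fun i hi => by
        rw [min_eq_left hi.le, min_eq_left (Nat.succ_le_of_lt hi)]
        exact w.seq_succ_mem i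
      seq_of_le := fun i hi => by
        have hclosed := w.periodic 0
        rw [zero_add, w.seq_zero] at hclosed
        rw [min_eq_right hi, hclosed] }
  invFun w :=
    { seq := fun j => w.seq (j % m)
      seq_zero := by rw [Nat.zero_mod, w.seq_zero]
      seq_succ_mem := fun j => by
        have hlt := Nat.mod_lt j hm
        have hstep := w.seq_succ_mem (j % m) hlt
        rw [← Nat.mod_add_mod]
        rcases (Nat.succ_le_of_lt hlt).lt_or_eq with hlt' | heq
        · rwa [Nat.mod_eq_of_lt hlt']
        · rw [Nat.succ_eq_add_one] at heq
          rw [heq, w.seq_of_le m le_rfl] at hstep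
          rwa [heq, Nat.mod_self, w.seq_zero]
      periodic := fun j => by rw [Nat.add_mod_right] }
  left_inv w := PeriodicChain.ext <| funext fun j => by
    dsimp only
    rw [min_eq_left (Nat.mod_lt j hm).le, Function.Periodic.map_mod_nat w.periodic]
  right_inv w := Chain.ext <| funext fun i => by
    dsimp only
    rcases lt_or_ge i m with hi | hi
    · rw [min_eq_left hi.le, Nat.mod_eq_of_lt hi]
    · rw [min_eq_right hi, Nat.mod_self, w.seq_zero, w.seq_of_le i hi]

end Chains

section DiagonalSum

open Classical in
/-- The sum of the diagonal entries at the points of `F` of an operator on functions. -/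
def diagonalSum {α R : Type*} [CommSemiring R] (F : Finset α) :
    Module.End R (α → R) →ₗ[R] R where
  toFun L := ∑ x ∈ F, L (Pi.single x 1) x
  map_add' _ _ := Finset.sum_add_distrib
  map_smul' _ _ := (Finset.mul_sum _ _ _).symm

theorem diagonalSum_apply {α R : Type*} [CommSemiring R] [DecidableEq α] (F : Finset α)
    (L : Module.End R (α → R)) : diagonalSum F L = ∑ x ∈ F, L (Pi.single x 1) x := by
  simp only [diagonalSum, LinearMap.coe_mk, AddHom.coe_mk]
  exact Finset.sum_congr rfl fun x _ => by congr!

end DiagonalSum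

section EdgeOperator

variable {V : Type*} (G : SimpleGraph V) [G.LocallyFinite]

/-- The adjacency operator on all functions on the vertices. -/
def adjacency : Module.End ℂ (V → ℂ) := sumOver ℂ fun x => G.neighborFinset x

/-- The operator that sums a function on the oriented edges over the edges that leave a vertex. -/
def outSum : (G.Dart → ℂ) →ₗ[ℂ] (V → ℂ) := sumOver ℂ fun x => dartsFrom G {x}

open Classical in
/-- The oriented edges that may follow `d` in a path without backtracking. -/
def nonbacktrackingSucc (d : G.Dart) : Finset G.Dart := (dartsFrom G {d.snd}).erase d.symm

/-- Hashimoto's edge operator: the sum over the oriented edges that may follow a given one in a path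
without backtracking. -/
def edgeOp : Module.End ℂ (G.Dart → ℂ) := sumOver ℂ (nonbacktrackingSucc G)

variable {G}

theorem mem_nonbacktrackingSucc {d e : G.Dart} :
    e ∈ nonbacktrackingSucc G d ↔ e ≠ d.symm ∧ e.fst = d.snd := by
  classical
  rw [nonbacktrackingSucc, Finset.mem_erase, mem_dartsFrom, Finset.mem_singleton]

theorem outSum_apply (f : G.Dart → ℂ) (x : V) : outSum G f x = ∑ d ∈ dartsFrom G {x}, f d := rfl

theorem edgeOp_apply (f : G.Dart → ℂ) (d : G.Dart) :
    edgeOp G f d = outSum G f d.snd - f d.symm := by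
  classical
  rw [edgeOp, sumOver_apply, nonbacktrackingSucc, outSum_apply]
  exact Finset.sum_erase_eq_sub (mem_dartsFrom.2 (Finset.mem_singleton_self _))

theorem outSum_comp_snd (g : V → ℂ) : outSum G (fun d => g d.snd) = adjacency G g :=
  funext fun x => sum_dartsFrom_singleton x g

theorem outSum_edgeOp (f : G.Dart → ℂ) :
    outSum G (edgeOp G f) = adjacency G (outSum G f) - outSum G fun d => f d.symm := by
  rw [← outSum_comp_snd, ← map_sub]
  exact congrArg _ (funext (edgeOp_apply f))

variable {q : ℕ}

theorem outSum_comp_fst (hG : G.IsRegularOfDegree (q + 1)) (g : V → ℂ) :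
    outSum G (fun d => g d.fst) = ((q : ℂ) + 1) • g := by
  ext x
  rw [outSum_apply, Finset.sum_congr rfl fun d hd =>
    congrArg g (Finset.mem_singleton.1 (mem_dartsFrom.1 hd)), Finset.sum_const, card_dartsFrom hG,
    Finset.card_singleton, one_mul, nsmul_eq_mul, Nat.cast_succ, Pi.smul_apply, smul_eq_mul]

theorem edgeOp_comp_fst (hG : G.IsRegularOfDegree (q + 1)) (g : V → ℂ) :
    edgeOp G (fun d => g d.fst) = (q : ℂ) • fun d : G.Dart => g d.snd := by
  ext d
  rw [edgeOp_apply, outSum_comp_fst hG]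
  simp only [Pi.smul_apply, smul_eq_mul, SimpleGraph.Dart.symm_toProd, Prod.fst_swap]
  ring

theorem outSum_edgeOp_comp_symm (hG : G.IsRegularOfDegree (q + 1)) (f : G.Dart → ℂ) :
    outSum G (fun d => edgeOp G f d.symm) = (q : ℂ) • outSum G f := by
  have hsymm : (fun d : G.Dart => edgeOp G f d.symm) = (fun d => outSum G f d.fst) - f :=
    funext fun d => by rw [edgeOp_apply, SimpleGraph.Dart.symm_symm]; rfl
  rw [hsymm, map_sub, outSum_comp_fst hG, add_smul, one_smul, add_sub_cancel_right]

/-- The operator on functions on the vertices that counts the walks of length `m + 1` without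
backtracking. -/
def nonbacktrackingWalkOp (G : SimpleGraph V) [G.LocallyFinite] (m : ℕ) :
    Module.End ℂ (V → ℂ) :=
  outSum G ∘ₗ (edgeOp G ^ m) ∘ₗ LinearMap.funLeft ℂ ℂ fun d => d.snd

theorem nonbacktrackingWalkOp_apply (m : ℕ) (g : V → ℂ) :
    nonbacktrackingWalkOp G m g = outSum G ((edgeOp G ^ m) fun d => g d.snd) := rfl

theorem nonbacktrackingWalkOp_zero : nonbacktrackingWalkOp G 0 = adjacency G :=
  LinearMap.ext outSum_comp_snd

theorem nonbacktrackingWalkOp_one (hG : G.IsRegularOfDegree (q + 1)) :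
    nonbacktrackingWalkOp G 1 = adjacency G ^ 2 - ((q : ℂ) + 1) • 1 := by
  ext1 g
  rw [nonbacktrackingWalkOp_apply, pow_one, outSum_edgeOp, outSum_comp_snd, sq]
  exact congrArg _ (outSum_comp_fst hG g)

theorem nonbacktrackingWalkOp_add_two (hG : G.IsRegularOfDegree (q + 1)) (m : ℕ) :
    nonbacktrackingWalkOp G (m + 2) =
      adjacency G * nonbacktrackingWalkOp G (m + 1) - (q : ℂ) • nonbacktrackingWalkOp G m := by
  ext1 g
  simp only [nonbacktrackingWalkOp_apply, LinearMap.sub_apply, LinearMap.smul_apply,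
    Module.End.mul_apply, pow_succ' (edgeOp G)]
  rw [outSum_edgeOp, outSum_edgeOp_comp_symm hG]

open Polynomial in
theorem nonbacktrackingWalkOp_add_two_sub (hG : G.IsRegularOfDegree (q + 1)) (m : ℕ) :
    nonbacktrackingWalkOp G (m + 2) - (q : ℂ) • nonbacktrackingWalkOp G m =
      aeval (adjacency G) (dickson 1 (q : ℂ) (m + 3) - dickson 1 (q : ℂ) (m + 1)) := by
  have hdickson (n : ℕ) : aeval (adjacency G) (dickson 1 (q : ℂ) (n + 2)) =
      adjacency G * aeval (adjacency G) (dickson 1 (q : ℂ) (n + 1)) -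
        (q : ℂ) • aeval (adjacency G) (dickson 1 (q : ℂ) n) := by
    rw [dickson_add_two, map_sub, map_mul, map_mul, aeval_X, aeval_C, Algebra.smul_def]
  have hone : aeval (adjacency G) (dickson 1 (q : ℂ) 1) = adjacency G := by
    rw [dickson_one, aeval_X]
  have hzero : aeval (adjacency G) (dickson 1 (q : ℂ) 0) = (2 : ℂ) • 1 := by
    rw [dickson_zero, map_sub, map_ofNat, map_natCast, two_smul]
    norm_num
  induction m using Nat.twoStepInduction with
  | zero =>
    rw [nonbacktrackingWalkOp_add_two hG, nonbacktrackingWalkOp_one hG,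
      nonbacktrackingWalkOp_zero, map_sub, hdickson, hdickson, hone, hzero]
    simp only [mul_sub, mul_smul_comm, mul_one, sq]
    module
  | one =>
    rw [nonbacktrackingWalkOp_add_two hG, nonbacktrackingWalkOp_add_two hG,
      nonbacktrackingWalkOp_one hG, nonbacktrackingWalkOp_zero, map_sub, hdickson, hdickson,
      hdickson, hone, hzero]
    simp only [mul_sub, mul_smul_comm, mul_one, sq]
    module
  | more m ih ih' =>
    calc nonbacktrackingWalkOp G (m + 4) - (q : ℂ) • nonbacktrackingWalkOp G (m + 2)
        = adjacency G *
              (nonbacktrackingWalkOp G (m + 3) - (q : ℂ) • nonbacktrackingWalkOp G (m + 1)) -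
            (q : ℂ) • (nonbacktrackingWalkOp G (m + 2) - (q : ℂ) • nonbacktrackingWalkOp G m) := by
          rw [nonbacktrackingWalkOp_add_two hG (m + 2), nonbacktrackingWalkOp_add_two hG m]
          simp only [mul_sub, mul_smul_comm]
          module
      _ = aeval (adjacency G) (dickson 1 (q : ℂ) (m + 5) - dickson 1 (q : ℂ) (m + 3)) := by
          rw [ih, ih', map_sub, map_sub, map_sub, hdickson (m + 3), hdickson (m + 1), mul_sub]
          module

end EdgeOperator

section Trace

variable {V : Type*} {G : SimpleGraph V} [G.LocallyFinite] {q : ℕ} {Γ : Subgroup (G ≃g G)}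
  {F : Finset V}

open Polynomial in
theorem coe_aeval_adjOp {d : ℕ} (hd : ∀ v, G.degree v ≤ d) (p : ℂ[X]) (f : L2 V) :
    ⇑(aeval (adjOp G d hd) p f) = aeval (adjacency G) p ⇑f := by
  induction p using Polynomial.induction_on' generalizing f with
  | add p r hp hr => rw [map_add, map_add, LinearMap.add_apply, ← hp, ← hr]; rfl
  | monomial n a =>
    rw [aeval_monomial, aeval_monomial, Algebra.algebraMap_eq_smul_one,
      Algebra.algebraMap_eq_smul_one, smul_one_mul, smul_one_mul, LinearMap.smul_apply]
    refine congrArg (a • ·) ?_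
    induction n generalizing f with
    | zero => rfl
    | succ n ih => rw [pow_succ, pow_succ]; exact ih (adjOp G d hd f)

open Polynomial in
theorem trace_aeval_adjOp {d : ℕ} (hd : ∀ v, G.degree v ≤ d) (F : Finset V) (p : ℂ[X]) :
    trace F (aeval (adjOp G d hd) p) = diagonalSum F (aeval (adjacency G) p) := by
  classical
  rw [diagonalSum_apply, trace]
  refine Finset.sum_congr rfl fun x _ => ?_
  rw [coe_aeval_adjOp]
  congr! 1

theorem dartsFrom_smul (γ : G ≃g G) (x : V) :
    dartsFrom G {γ x} = (dartsFrom G {x}).map (MulAction.toPerm γ).toEmbedding := by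
  ext d
  rw [Finset.mem_map_equiv, mem_dartsFrom, mem_dartsFrom, Finset.mem_singleton,
    Finset.mem_singleton]
  exact γ.toEquiv.symm_apply_eq.symm

theorem nonbacktrackingSucc_smul (γ : G ≃g G) (d : G.Dart) :
    nonbacktrackingSucc G (MulAction.toPerm γ d) =
      (nonbacktrackingSucc G d).map (MulAction.toPerm γ).toEmbedding := by
  ext e
  rw [Finset.mem_map_equiv, mem_nonbacktrackingSucc, mem_nonbacktrackingSucc]
  exact and_congr (not_congr ((MulAction.toPerm γ).symm_apply_eq (y := d.symm)).symm)
    γ.toEquiv.symm_apply_eq.symm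

theorem edgeOp_pow_single_smul [DecidableEq G.Dart] (m : ℕ) (γ : G ≃g G) (d e : G.Dart) :
    (edgeOp G ^ m) (Pi.single (γ • d) 1) (γ • e) = (edgeOp G ^ m) (Pi.single d 1) e := by
  have hsingle : (Pi.single (γ • d) 1 : G.Dart → ℂ) ∘ MulAction.toPerm γ = Pi.single d 1 := by
    ext e'
    simp only [Function.comp_apply, MulAction.toPerm_apply, Pi.single_apply, smul_left_cancel_iff]
  rw [← hsingle]
  exact (congrFun (sumOver_pow_comp_equiv (MulAction.toPerm γ) (nonbacktrackingSucc_smul γ) m _)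
    e).symm

theorem single_comp_snd [DecidableEq V] (x : V) :
    (fun d : G.Dart => (Pi.single x 1 : V → ℂ) d.snd) =
      ∑ d ∈ dartsFrom G {x}, Pi.single d.symm 1 := by
  ext e
  rw [Finset.sum_apply]
  have hsymm (d : G.Dart) :
      (Pi.single d.symm 1 : G.Dart → ℂ) e = if d = e.symm then 1 else 0 := by
    rw [Pi.single_apply]
    exact if_congr (eq_comm.trans SimpleGraph.Dart.symm_involutive.eq_iff) rfl rfl
  simp only [hsymm, Finset.sum_ite_eq', mem_dartsFrom, Finset.mem_singleton, Pi.single_apply]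
  rfl

theorem single_comp_fst [DecidableEq V] (x : V) :
    (fun d : G.Dart => (Pi.single x 1 : V → ℂ) d.fst) = ∑ d ∈ dartsFrom G {x}, Pi.single d 1 := by
  ext e
  simp only [Finset.sum_apply, Pi.single_apply, Finset.sum_ite_eq, mem_dartsFrom,
    Finset.mem_singleton]

/-- The trace modulo `Γ` of `edgeOp ^ m` composed with the reversal of the oriented edges. -/
def reversedEdgeTrace [DecidableEq V] (G : SimpleGraph V) [G.LocallyFinite] (F : Finset V)
    (m : ℕ) : ℂ :=
  ∑ d ∈ dartsFrom G F, (edgeOp G ^ m) (Pi.single d 1) d.symm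

theorem sum_outSum_edgeOp_pow_snd [DecidableEq V] (hfree : ActsFreely Γ)
    (hF : IsRepresentatives Γ F) (m : ℕ) :
    ∑ d ∈ dartsFrom G F, outSum G ((edgeOp G ^ m) (Pi.single d 1)) d.snd =
      diagonalSum F (nonbacktrackingWalkOp G m) := by
  have hinvariant (γ : G ≃g G) (d : G.Dart) :
      outSum G ((edgeOp G ^ m) (Pi.single (γ • d) 1)) (γ • d).snd =
        outSum G ((edgeOp G ^ m) (Pi.single d 1)) d.snd := by
    rw [snd_smul, outSum_apply, dartsFrom_smul, Finset.sum_map]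
    exact Finset.sum_congr rfl fun e _ => edgeOp_pow_single_smul m γ d e
  rw [← sum_dartsFrom_symm hfree hF _ fun γ _ => hinvariant γ, sum_dartsFrom, diagonalSum_apply]
  refine Finset.sum_congr rfl fun x _ => ?_
  rw [nonbacktrackingWalkOp_apply, single_comp_snd, map_sum, map_sum, Finset.sum_apply]
  exact Finset.sum_congr rfl fun d hd =>
    congrArg _ (Finset.mem_singleton.1 (mem_dartsFrom.1 hd))

theorem sum_outSum_edgeOp_pow_succ_fst [DecidableEq V] (hG : G.IsRegularOfDegree (q + 1))
    (F : Finset V) (m : ℕ) :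
    ∑ d ∈ dartsFrom G F, outSum G ((edgeOp G ^ (m + 1)) (Pi.single d 1)) d.fst =
      q * diagonalSum F (nonbacktrackingWalkOp G m) := by
  rw [sum_dartsFrom, diagonalSum_apply, Finset.mul_sum]
  refine Finset.sum_congr rfl fun x _ => ?_
  calc ∑ d ∈ dartsFrom G {x}, outSum G ((edgeOp G ^ (m + 1)) (Pi.single d 1)) d.fst
      = ∑ d ∈ dartsFrom G {x}, outSum G ((edgeOp G ^ (m + 1)) (Pi.single d 1)) x :=
        Finset.sum_congr rfl fun d hd => congrArg _ (Finset.mem_singleton.1 (mem_dartsFrom.1 hd))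
    _ = outSum G ((edgeOp G ^ (m + 1)) fun d => (Pi.single x 1 : V → ℂ) d.fst) x := by
        rw [single_comp_fst, map_sum, map_sum, Finset.sum_apply]
    _ = q * nonbacktrackingWalkOp G m (Pi.single x 1) x := by
        rw [pow_succ, Module.End.mul_apply, edgeOp_comp_fst hG, map_smul, map_smul]
        rfl

theorem diagonalSum_edgeOp_pow_succ [DecidableEq V] (hfree : ActsFreely Γ)
    (hF : IsRepresentatives Γ F) (m : ℕ) :
    diagonalSum (dartsFrom G F) (edgeOp G ^ (m + 1)) =
      diagonalSum F (nonbacktrackingWalkOp G m) - reversedEdgeTrace G F m := by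
  simp only [diagonalSum_apply (dartsFrom G F), reversedEdgeTrace, pow_succ' (edgeOp G),
    Module.End.mul_apply, edgeOp_apply, Finset.sum_sub_distrib]
  rw [sum_outSum_edgeOp_pow_snd hfree hF]

theorem reversedEdgeTrace_zero [DecidableEq V] (F : Finset V) : reversedEdgeTrace G F 0 = 0 :=
  Finset.sum_eq_zero fun d _ => Pi.single_eq_of_ne d.symm_ne 1

theorem reversedEdgeTrace_succ [DecidableEq V] (F : Finset V) (m : ℕ) :
    reversedEdgeTrace G F (m + 1) =
      ∑ d ∈ dartsFrom G F, outSum G ((edgeOp G ^ m) (Pi.single d 1)) d.fst -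
        diagonalSum (dartsFrom G F) (edgeOp G ^ m) := by
  simp only [reversedEdgeTrace, pow_succ' (edgeOp G), Module.End.mul_apply, edgeOp_apply,
    Finset.sum_sub_distrib, SimpleGraph.Dart.symm_symm, diagonalSum_apply]
  rfl

theorem reversedEdgeTrace_one [DecidableEq V] (F : Finset V) : reversedEdgeTrace G F 1 = 0 := by
  rw [← zero_add 1, reversedEdgeTrace_succ, diagonalSum_apply, ← Finset.sum_sub_distrib]
  refine Finset.sum_eq_zero fun d _ => sub_eq_zero.2 ?_
  rw [pow_zero, Module.End.one_apply, Pi.single_eq_same, outSum_apply, Finset.sum_pi_single',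
    if_pos (mem_dartsFrom.2 (Finset.mem_singleton_self _))]

theorem diagonalSum_edgeOp_pow_add_three (hfree : ActsFreely Γ) (hF : IsRepresentatives Γ F)
    (hG : G.IsRegularOfDegree (q + 1)) (m : ℕ) :
    diagonalSum (dartsFrom G F) (edgeOp G ^ (m + 3)) =
      diagonalSum F (nonbacktrackingWalkOp G (m + 2) - (q : ℂ) • nonbacktrackingWalkOp G m) +
        diagonalSum (dartsFrom G F) (edgeOp G ^ (m + 1)) := by
  classical
  rw [diagonalSum_edgeOp_pow_succ hfree hF (m + 2), reversedEdgeTrace_succ,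
    sum_outSum_edgeOp_pow_succ_fst hG, map_sub, map_smul, smul_eq_mul]
  ring

open Polynomial in
/-- The formula fails for the zeroth power, hence the shift. -/
theorem diagonalSum_edgeOp_pow (hfree : ActsFreely Γ) (hF : IsRepresentatives Γ F)
    (hG : G.IsRegularOfDegree (q + 1)) (m : ℕ) :
    diagonalSum (dartsFrom G F) (edgeOp G ^ (m + 1)) =
      trace F (aeval (regularAdjOp G hG) (dickson 1 (q : ℂ) (m + 1))) +
        F.card * ((q : ℂ) - 1) * (1 + (-1) ^ (m + 1)) / 2 := by
  classical
  have hone : diagonalSum F (1 : Module.End ℂ (V → ℂ)) = F.card := by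
    simp only [diagonalSum_apply, Module.End.one_apply, Pi.single_eq_same, Finset.sum_const,
      nsmul_one]
  rw [trace_aeval_adjOp]
  induction m using Nat.twoStepInduction with
  | zero =>
    rw [diagonalSum_edgeOp_pow_succ hfree hF, nonbacktrackingWalkOp_zero, reversedEdgeTrace_zero,
      zero_add, dickson_one, aeval_X]
    ring
  | one =>
    have hdickson : aeval (adjacency G) (dickson 1 (q : ℂ) 2) =
        adjacency G ^ 2 - (2 * q : ℂ) • 1 := by
      rw [dickson_two, Nat.cast_one, show (3 - 1 : ℂ[X]) = C 2 by rw [C_ofNat]; norm_num, ← C_mul,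
        map_sub, map_pow, aeval_X, aeval_C, Algebra.algebraMap_eq_smul_one, mul_comm]
    rw [diagonalSum_edgeOp_pow_succ hfree hF, nonbacktrackingWalkOp_one hG, reversedEdgeTrace_one,
      hdickson, map_sub, map_sub, map_smul, map_smul, hone, smul_eq_mul, smul_eq_mul]
    ring
  | more m ih _ =>
    rw [diagonalSum_edgeOp_pow_add_three hfree hF hG, nonbacktrackingWalkOp_add_two_sub hG, ih,
      map_sub, map_sub]
    ring

end Trace

/-! ### Closed paths and prime cycles -/

namespace ClosedPath

variable {V : Type*} {G : SimpleGraph V}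

theorem vert_mod (C : ClosedPath G) (j : ℕ) : C.vert (j % C.len) = C.vert j :=
  Function.Periodic.map_mod_nat C.periodic j

theorem one_lt_len (C : ClosedPath G) : 1 < C.len := by
  refine lt_of_le_of_ne C.len_pos fun hlen => (C.adj 0).ne ?_
  rw [hlen, C.periodic]

theorem vert_len (C : ClosedPath G) : C.vert C.len = C.vert 0 := by
  rw [← C.periodic 0, zero_add]

theorem hasBacktracking_iff (C : ClosedPath G) :
    C.HasBacktracking ↔ ∃ j, j + 1 < C.len ∧ C.vert j = C.vert (j + 2) := by
  constructor
  · rintro ⟨_ | j, hj, hlt, hv⟩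
    · exact absurd hj (Nat.not_succ_le_zero 0)
    · exact ⟨j, hlt, hv⟩
  · rintro ⟨j, hlt, hv⟩
    exact ⟨j + 1, Nat.le_add_left 1 j, hlt, hv⟩

theorem hasTail_iff (C : ClosedPath G) :
    C.HasTail ↔ 4 ≤ C.len ∧ C.vert (C.len - 1) = C.vert 1 := by
  constructor
  · rintro ⟨k, hk, hk', hv⟩
    exact ⟨by omega, (hv 1 le_rfl hk).symm⟩
  · rintro ⟨hlen, hv⟩
    refine ⟨1, le_rfl, by omega, fun j hj hj' => ?_⟩
    rw [le_antisymm hj' hj, hv]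

/-- A path of length two backtracks as soon as it has a tail, and in a path of length three a tail
would be a loop; this is why tails of such short paths need not be excluded. -/
theorem IsReduced.vert_len_sub_one_ne {C : ClosedPath G} (hC : C.IsReduced) :
    C.vert (C.len - 1) ≠ C.vert 1 := by
  intro hv
  have hlen := C.one_lt_len
  rcases Nat.lt_or_ge C.len 4 with hlt | hge
  · rcases (by omega : C.len = 2 ∨ C.len = 3) with htwo | hthree
    · refine hC.1 (C.hasBacktracking_iff.2 ⟨0, by omega, ?_⟩)
      rw [← C.vert_len, htwo]
    · refine (C.adj 1).ne ?_
      rw [← hv, hthree]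
  · exact hC.2 (C.hasTail_iff.2 ⟨hge, hv⟩)

theorem isReduced_iff (C : ClosedPath G) : C.IsReduced ↔ ∀ j, C.vert j ≠ C.vert (j + 2) := by
  have hvert_len_add_one : C.vert (C.len + 1) = C.vert 1 := by rw [add_comm, C.periodic]
  constructor
  · intro hC j hv
    have hlt := Nat.mod_lt j C.len_pos
    have hv' : C.vert (j % C.len) = C.vert (j % C.len + 2) := by
      rw [C.vert_mod, hv, ← C.vert_mod (j % C.len + 2), Nat.mod_add_mod, C.vert_mod]
    rcases (Nat.succ_le_of_lt hlt).lt_or_eq with hlt' | hlast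
    · exact hC.1 (C.hasBacktracking_iff.2 ⟨_, hlt', hv'⟩)
    · refine hC.vert_len_sub_one_ne ?_
      rw [← hvert_len_add_one, ← hlast]
      exact hv'
  · intro hC
    refine ⟨fun hback => ?_, fun htail => ?_⟩
    · obtain ⟨j, -, hv⟩ := C.hasBacktracking_iff.1 hback
      exact hC j hv
    · obtain ⟨hlen, hv⟩ := C.hasTail_iff.1 htail
      refine hC (C.len - 1) ?_
      rw [hv, ← hvert_len_add_one]
      congr 1
      omega

/-- The oriented edge from the `j`-th vertex to the next one. -/
def dart (C : ClosedPath G) (j : ℕ) : G.Dart := ⟨(C.vert j, C.vert (j + 1)), C.adj j⟩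

theorem dart_periodic (C : ClosedPath G) (j : ℕ) : C.dart (j + C.len) = C.dart j :=
  SimpleGraph.Dart.ext _ _ <| Prod.ext (C.periodic j) <| by
    change C.vert (j + C.len + 1) = C.vert (j + 1)
    rw [Nat.add_right_comm, C.periodic]

theorem dart_succ_mem_nonbacktrackingSucc_iff [G.LocallyFinite] (C : ClosedPath G) (j : ℕ) :
    C.dart (j + 1) ∈ nonbacktrackingSucc G (C.dart j) ↔ C.vert j ≠ C.vert (j + 2) := by
  rw [mem_nonbacktrackingSucc, Ne, SimpleGraph.Dart.ext_iff, Prod.ext_iff]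
  simp only [dart, SimpleGraph.Dart.symm_toProd, Prod.fst_swap, Prod.snd_swap, true_and, and_true,
    ne_comm (a := C.vert j)]

end ClosedPath

section Counting

variable {V : Type*} {G : SimpleGraph V} [G.LocallyFinite]

theorem PeriodicChain.fst_seq_succ {m : ℕ} {d : G.Dart}
    (w : PeriodicChain (nonbacktrackingSucc G) m d) (j : ℕ) :
    (w.seq (j + 1)).fst = (w.seq j).snd :=
  (mem_nonbacktrackingSucc.1 (w.seq_succ_mem j)).2

/-- The closed path formed by the initial vertices of a periodic chain of oriented edges. -/
def PeriodicChain.toClosedPath {m : ℕ} (hm : 0 < m) {d : G.Dart}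
    (w : PeriodicChain (nonbacktrackingSucc G) m d) : ClosedPath G where
  len := m
  len_pos := hm
  vert j := (w.seq j).fst
  periodic j := by rw [w.periodic]
  adj j := by
    rw [w.fst_seq_succ]
    exact (w.seq j).adj

theorem PeriodicChain.dart_toClosedPath {m : ℕ} (hm : 0 < m) {d : G.Dart}
    (w : PeriodicChain (nonbacktrackingSucc G) m d) (j : ℕ) :
    (w.toClosedPath hm).dart j = w.seq j :=
  SimpleGraph.Dart.ext _ _ <| Prod.ext rfl (w.fst_seq_succ j)

/-- Reduced closed paths are the periodic chains of oriented edges without backtracking. -/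
def reducedEquivPeriodicChain {m : ℕ} (hm : 0 < m) (d : G.Dart) :
    {C : ClosedPath G // C.IsReduced ∧ C.len = m ∧ C.dart 0 = d} ≃
      PeriodicChain (nonbacktrackingSucc G) m d where
  toFun C :=
    { seq := C.1.dart
      seq_zero := C.2.2.2
      seq_succ_mem := fun j =>
        (C.1.dart_succ_mem_nonbacktrackingSucc_iff j).2 (C.1.isReduced_iff.1 C.2.1 j)
      periodic := fun j => by
        have periodic := C.1.dart_periodic j
        rwa [C.2.2.1] at periodic }
  invFun w :=
    ⟨w.toClosedPath hm, (w.toClosedPath hm).isReduced_iff.2 fun j => by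
      rw [← ClosedPath.dart_succ_mem_nonbacktrackingSucc_iff, w.dart_toClosedPath,
        w.dart_toClosedPath]
      exact w.seq_succ_mem j, rfl, (w.dart_toClosedPath hm 0).trans w.seq_zero⟩
  left_inv C := Subtype.ext <| ClosedPath.ext C.2.2.1.symm rfl
  right_inv w := PeriodicChain.ext <| funext <| w.dart_toClosedPath hm

/-- The reduced closed paths that start in `F`. -/
def ReducedFrom (G : SimpleGraph V) (F : Finset V) : Type _ :=
  {C : ClosedPath G // C.IsReduced ∧ C.vert 0 ∈ F}

/-- The reduced closed paths of length `m` that start in `F`, sorted by their first oriented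
edge. -/
def reducedFromLenEquiv (F : Finset V) {m : ℕ} (hm : 0 < m) :
    {C : ReducedFrom G F // C.1.len = m} ≃
      Σ d : dartsFrom G F, Chain (nonbacktrackingSucc G) m d.1 d.1 :=
  Equiv.trans
    { toFun := fun C => ⟨⟨C.1.1.dart 0, mem_dartsFrom.2 C.1.2.2⟩, C.1.1, C.1.2.1, C.2, rfl⟩
      invFun := fun p => ⟨⟨p.2.1, p.2.2.1, by
        have hfst := mem_dartsFrom.1 p.1.2
        rwa [← p.2.2.2.2] at hfst⟩, p.2.2.2.1⟩
      left_inv := fun C => rfl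
      right_inv := by
        rintro ⟨⟨d, hd⟩, C, hred, hlen, hdart⟩
        obtain rfl : C.dart 0 = d := hdart
        rfl }
    (Equiv.sigmaCongrRight fun d : dartsFrom G F =>
      (reducedEquivPeriodicChain hm d.1).trans (periodicChainEquiv _ hm d.1))

theorem finite_reducedFrom_len (F : Finset V) (m : ℕ) :
    Finite {C : ReducedFrom G F // C.1.len = m} := by
  rcases m.eq_zero_or_pos with rfl | hm
  · have : IsEmpty {C : ReducedFrom G F // C.1.len = 0} := ⟨fun C => C.1.1.len_pos.ne' C.2⟩
    infer_instance
  · exact Finite.of_equiv _ (reducedFromLenEquiv F hm).symm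

theorem card_reducedFrom_len (F : Finset V) {m : ℕ} (hm : 0 < m) :
    (Nat.card {C : ReducedFrom G F // C.1.len = m} : ℂ) =
      diagonalSum (dartsFrom G F) (edgeOp G ^ m) := by
  classical
  rw [Nat.card_congr (reducedFromLenEquiv F hm), Nat.card_sigma, Nat.cast_sum,
    diagonalSum_apply, ← Finset.sum_coe_sort (dartsFrom G F)]
  exact Finset.sum_congr rfl fun d _ => card_chain _ m d.1 d.1

end Counting

namespace ClosedPath

variable {V : Type*} {G : SimpleGraph V}

/-- The shift of a sequence, whose periodic points are the periodic sequences. -/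
def seqShift (w : ℕ → V) : ℕ → V := fun j => w (j + 1)

theorem seqShift_iterate (n : ℕ) (w : ℕ → V) (j : ℕ) : seqShift^[n] w j = w (j + n) := by
  induction n generalizing w with
  | zero => rfl
  | succ n ih => rw [Function.iterate_succ_apply, ih]; rfl

theorem isPeriodicPt_seqShift {n : ℕ} {w : ℕ → V} :
    Function.IsPeriodicPt seqShift n w ↔ ∀ j, w (j + n) = w j := by
  rw [Function.IsPeriodicPt, Function.IsFixedPt, funext_iff]
  simp only [seqShift_iterate]

theorem isPeriodicPt (C : ClosedPath G) : Function.IsPeriodicPt seqShift C.len C.vert :=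
  isPeriodicPt_seqShift.2 C.periodic

/-- The least period of the sequence of vertices. -/
def period (C : ClosedPath G) : ℕ := Function.minimalPeriod seqShift C.vert

theorem period_dvd_of_periodic (C : ClosedPath G) {n : ℕ} (hn : ∀ j, C.vert (j + n) = C.vert j) :
    C.period ∣ n := (isPeriodicPt_seqShift.2 hn).minimalPeriod_dvd

theorem period_dvd_len (C : ClosedPath G) : C.period ∣ C.len :=
  C.period_dvd_of_periodic C.periodic

theorem period_pos (C : ClosedPath G) : 0 < C.period := C.isPeriodicPt.minimalPeriod_pos C.len_pos

theorem vert_add_period (C : ClosedPath G) (j : ℕ) : C.vert (j + C.period) = C.vert j :=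
  isPeriodicPt_seqShift.1 (Function.isPeriodicPt_minimalPeriod _ _) j

/-- The primitive closed path with the same sequence of vertices. -/
def root (C : ClosedPath G) : ClosedPath G where
  len := C.period
  len_pos := C.period_pos
  vert := C.vert
  periodic := C.vert_add_period
  adj := C.adj

/-- Going `n + 1` times around a closed path. -/
def power (C : ClosedPath G) (n : ℕ) : ClosedPath G where
  len := (n + 1) * C.len
  len_pos := Nat.mul_pos n.succ_pos C.len_pos
  vert := C.vert
  periodic := fun j => C.vert_add_mul j (n + 1)
  adj := C.adj

/-- A closed path with shifted origin. -/
def rotate (C : ClosedPath G) (k : ℕ) : ClosedPath G where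
  len := C.len
  len_pos := C.len_pos
  vert := fun j => C.vert (j + k)
  periodic := fun j => by rw [Nat.add_right_comm, C.periodic]
  adj := fun j => by rw [Nat.add_right_comm]; exact C.adj (j + k)

theorem isPrimitive_iff (C : ClosedPath G) : C.IsPrimitive ↔ C.period = C.len := by
  constructor
  · intro hC
    obtain ⟨n, hn⟩ := C.period_dvd_len
    have hn_pos : 0 < n := Nat.pos_of_mul_pos_left (hn ▸ C.len_pos)
    obtain rfl | hn_two := (Nat.succ_le_of_lt hn_pos).eq_or_lt
    · exact (hn.trans (mul_one _)).symm
    · exact absurd ⟨C.root, n, hn_two, hn.trans (mul_comm _ _), fun _ => rfl⟩ hC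
  · rintro hC ⟨D, n, hn, hlen, hvert⟩
    have hdvd : C.period ∣ D.len :=
      C.period_dvd_of_periodic fun j => by rw [hvert, hvert, D.periodic]
    have hle := Nat.le_of_dvd D.len_pos hdvd
    rw [hC, hlen] at hle
    exact absurd (Nat.le_of_mul_le_mul_right (hle.trans_eq (one_mul _).symm) D.len_pos) (by omega)

theorem root_isPrimitive (C : ClosedPath G) : C.root.IsPrimitive := C.root.isPrimitive_iff.2 rfl

theorem IsReduced.of_vert {C D : ClosedPath G} (hC : C.IsReduced) (k : ℕ)
    (hvert : ∀ j, D.vert j = C.vert (j + k)) : D.IsReduced := by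
  rw [isReduced_iff] at hC ⊢
  intro j
  rw [hvert, hvert, Nat.add_right_comm]
  exact hC _

theorem IsReduced.smul {C : ClosedPath G} (hC : C.IsReduced) (γ : G ≃g G) :
    (γ • C).IsReduced := by
  rw [isReduced_iff] at hC ⊢
  exact fun j hj => hC j (γ.injective hj)

theorem IsPrimitive.smul {C : ClosedPath G} (hC : C.IsPrimitive) (γ : G ≃g G) :
    (γ • C).IsPrimitive := by
  rintro ⟨D, n, hn, hlen, hvert⟩
  refine hC ⟨γ⁻¹ • D, n, hn, hlen, fun j => ?_⟩
  rw [vert_smul, ← hvert, vert_smul, RelIso.inv_apply_self]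

theorem rotate_mod (C : ClosedPath G) (k : ℕ) : C.rotate (k % C.len) = C.rotate k := by
  refine ClosedPath.ext rfl (funext fun j => ?_)
  change C.vert (j + k % C.len) = C.vert (j + k)
  rw [← C.vert_mod (j + k % C.len), ← C.vert_mod (j + k), Nat.add_mod_mod]

theorem IsPrimitive.rotate {C : ClosedPath G} (hC : C.IsPrimitive) (k : ℕ) :
    (C.rotate k).IsPrimitive := by
  rintro ⟨D, n, hn, hlen, hvert⟩
  refine hC ⟨D.rotate (k * C.len - k), n, hn, hlen, fun j => ?_⟩
  change C.vert j = D.vert (j + (k * C.len - k))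
  rw [← hvert]
  change C.vert j = C.vert (j + (k * C.len - k) + k)
  rw [Nat.add_assoc, Nat.sub_add_cancel (Nat.le_mul_of_pos_right k C.len_pos), vert_add_mul]

theorem IsPrimitive.rotate_injOn {C : ClosedPath G} (hC : C.IsPrimitive) :
    Set.InjOn C.rotate (Set.Iio C.len) := by
  intro i hi j hj hij
  rw [← C.isPrimitive_iff.1 hC] at hi hj
  refine Function.iterate_injOn_Iio_minimalPeriod hi hj (funext fun m => ?_)
  change seqShift^[i] C.vert m = seqShift^[j] C.vert m
  rw [seqShift_iterate, seqShift_iterate]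
  exact congrFun (congrArg ClosedPath.vert hij) m

/-- The cycle of a closed path. -/
def toCycle (C : ClosedPath G) : Cycle G := Quotient.mk (ClosedPath.setoid G) C

theorem toCycle_eq_iff {C D : ClosedPath G} : C.toCycle = D.toCycle ↔ ∃ k, D = C.rotate k := by
  refine Quotient.eq.trans ⟨?_, ?_⟩
  · rintro ⟨hlen, k, hvert⟩
    exact ⟨k, ClosedPath.ext hlen (funext hvert)⟩
  · rintro ⟨k, rfl⟩
    exact ⟨rfl, k, fun _ => rfl⟩

theorem IsPrimitive.card_toCycle_fiber {C : ClosedPath G} (hC : C.IsPrimitive) :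
    Nat.card {D : ClosedPath G // D.toCycle = C.toCycle} = C.len := by
  rw [← Nat.card_fin C.len]
  refine (Nat.card_eq_of_bijective (fun j : Fin C.len =>
    ⟨C.rotate j, (toCycle_eq_iff.2 ⟨j, rfl⟩).symm⟩) ⟨fun i j hij => ?_, ?_⟩).symm
  · exact Fin.ext (hC.rotate_injOn i.2 j.2 (congrArg Subtype.val hij))
  · rintro ⟨D, hD⟩
    obtain ⟨k, rfl⟩ := toCycle_eq_iff.1 hD.symm
    exact ⟨⟨k % C.len, Nat.mod_lt k C.len_pos⟩, Subtype.ext (C.rotate_mod k)⟩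

theorem isReduced_and_isPrimitive_of_isPrime {C : ClosedPath G} (hC : C.toCycle.IsPrime) :
    C.IsReduced ∧ C.IsPrimitive := by
  obtain ⟨D, hreduced, hprimitive, hD⟩ := hC
  obtain ⟨k, rfl⟩ := toCycle_eq_iff.1 hD
  exact ⟨hreduced.of_vert k fun _ => rfl, hprimitive.rotate k⟩

end ClosedPath

namespace Cycle

variable {V : Type*} {G : SimpleGraph V}

theorem len_pos (c : Cycle G) : 0 < c.len := by
  obtain ⟨C⟩ := c
  exact C.len_pos

theorem len_smul (γ : G ≃g G) (c : Cycle G) : (γ • c).len = c.len := by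
  obtain ⟨C⟩ := c
  rfl

theorem IsPrime.card_toCycle_fiber {c : Cycle G} (hc : c.IsPrime) :
    Nat.card {C : ClosedPath G // C.toCycle = c} = c.len := by
  obtain ⟨C, -, hprimitive, rfl⟩ := hc
  exact hprimitive.card_toCycle_fiber

end Cycle

section Primitive

variable {V : Type*} {G : SimpleGraph V}

/-- The primitive reduced closed paths that start in `F`. -/
def PrimitiveFrom (G : SimpleGraph V) (F : Finset V) : Type _ :=
  {C : ClosedPath G // C.IsReduced ∧ C.IsPrimitive ∧ C.vert 0 ∈ F}

/-- Every reduced closed path is a power of a unique primitive one. -/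
def primitiveFromProdEquiv (F : Finset V) : PrimitiveFrom G F × ℕ ≃ ReducedFrom G F where
  toFun p := ⟨p.1.1.power p.2, p.1.2.1.of_vert 0 fun _ => rfl, p.1.2.2.2⟩
  invFun C := ⟨⟨C.1.root, C.2.1.of_vert 0 fun _ => rfl, C.1.root_isPrimitive, C.2.2⟩,
    C.1.len / C.1.period - 1⟩
  left_inv := by
    rintro ⟨⟨C, -, hprimitive, -⟩, n⟩
    have hperiod : C.period = C.len := C.isPrimitive_iff.1 hprimitive
    refine Prod.ext (Subtype.ext (ClosedPath.ext hperiod rfl)) ?_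
    change (n + 1) * C.len / C.period - 1 = n
    rw [hperiod, Nat.mul_div_cancel _ C.len_pos, Nat.add_sub_cancel]
  right_inv := by
    rintro ⟨C, -, -⟩
    refine Subtype.ext (ClosedPath.ext ?_ rfl)
    change (C.len / C.period - 1 + 1) * C.period = C.len
    rw [Nat.sub_add_cancel, Nat.div_mul_cancel C.period_dvd_len]
    exact Nat.div_pos (Nat.le_of_dvd C.len_pos C.period_dvd_len) C.period_pos

variable {Γ : Subgroup (G ≃g G)} {F : Finset V}

/-- The translate by `Γ` of a primitive reduced closed path that starts in the set `F` of
representatives. -/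
def translateToRepresentatives (hF : IsRepresentatives Γ F) (C : ClosedPath G)
    (hC : C.toCycle.IsPrime) : PrimitiveFrom G F :=
  ⟨carry hF (C.vert 0) • C, (C.isReduced_and_isPrimitive_of_isPrime hC).1.smul _,
    (C.isReduced_and_isPrimitive_of_isPrime hC).2.smul _, carry_apply_mem hF _⟩

theorem PrimitiveFrom.carry_smul (hfree : ActsFreely Γ) (hF : IsRepresentatives Γ F)
    (D : PrimitiveFrom G F) {γ : G ≃g G} (hγ : γ ∈ Γ) :
    carry hF ((γ • D.1).vert 0) = γ⁻¹ :=
  carry_eq hfree hF (Γ.inv_mem hγ) (by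
    rw [ClosedPath.vert_smul, RelIso.inv_apply_self]
    exact D.2.2.2)

/-- Since `Γ` acts freely, every closed path in a prime cycle `c` is `γ • D` for exactly one `γ ∈ Γ`
and one closed path `D` that starts in `F`. -/
def translatedFiberEquiv (hfree : ActsFreely Γ) (hF : IsRepresentatives Γ F) (c : PrimeCycle G) :
    {p : PrimitiveFrom G F × Γ // p.2 • p.1.1.toCycle = c.1} ≃
      {C : ClosedPath G // C.toCycle = c.1} where
  toFun p := ⟨p.1.2 • p.1.1.1, p.2⟩
  invFun C := ⟨⟨translateToRepresentatives hF C.1 (by rw [C.2]; exact c.2),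
    (⟨carry hF (C.1.vert 0), carry_mem hF _⟩ : Γ)⁻¹⟩, (inv_smul_smul _ C.1.toCycle).trans C.2⟩
  left_inv := by
    rintro ⟨⟨D, γ⟩, hp⟩
    have hcarry := D.carry_smul hfree hF γ.2
    refine Subtype.ext (Prod.ext (Subtype.ext ?_) (Subtype.ext ?_))
    · change carry hF ((γ.1 • D.1).vert 0) • γ.1 • D.1 = D.1
      rw [hcarry, inv_smul_smul]
    · change (carry hF ((γ.1 • D.1).vert 0))⁻¹ = γ.1
      rw [hcarry, inv_inv]
  right_inv C := Subtype.ext (inv_smul_smul (carry hF (C.1.vert 0)) C.1)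

variable (Γ) in
/-- The `Γ`-class of the cycle of a primitive reduced closed path. -/
def PrimitiveFrom.primeClass (D : PrimitiveFrom G F) : PrimeClass Γ :=
  Quotient.mk (primeSetoid Γ) ⟨D.1.toCycle, D.1, D.2.1, D.2.2.1, rfl⟩

theorem PrimitiveFrom.primeClass_eq_iff (D : PrimitiveFrom G F) (c : PrimeCycle G) :
    D.primeClass Γ = Quotient.mk (primeSetoid Γ) c ↔ ∃ γ ∈ Γ, γ • D.1.toCycle = c.1 :=
  Quotient.eq

theorem PrimitiveFrom.len_eq_of_primeClass_eq {D : PrimitiveFrom G F} {c : PrimeCycle G}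
    (hD : D.primeClass Γ = Quotient.mk (primeSetoid Γ) c) : D.1.len = c.1.len := by
  obtain ⟨γ, -, hγ⟩ := (D.primeClass_eq_iff c).1 hD
  rw [← hγ, Cycle.len_smul]
  rfl

/-- The elements of `Γ` that carry the cycle of `D` to `c` form a coset of the stabilizer. -/
def primeClassFiberProdStabilizerEquiv (c : PrimeCycle G) :
    {D : PrimitiveFrom G F // D.primeClass Γ = Quotient.mk (primeSetoid Γ) c} ×
        MulAction.stabilizer Γ c.1 ≃
      {p : PrimitiveFrom G F × Γ // p.2 • p.1.1.toCycle = c.1} :=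
  have hexists (D : {D : PrimitiveFrom G F // D.primeClass Γ = Quotient.mk (primeSetoid Γ) c}) :
      ∃ γ : Γ, γ • D.1.1.toCycle = c.1 := by
    obtain ⟨γ, hγ, hD⟩ := (D.1.primeClass_eq_iff c).1 D.2
    exact ⟨⟨γ, hγ⟩, hD⟩
  let transporter D := (hexists D).choose
  have htransporter D : transporter D • D.1.1.toCycle = c.1 := (hexists D).choose_spec
  { toFun := fun p => ⟨⟨p.1.1, p.2.1 * transporter p.1⟩, by
      rw [mul_smul, htransporter]
      exact p.2.2⟩
    invFun := fun p =>
      let D : {D : PrimitiveFrom G F // D.primeClass Γ = Quotient.mk (primeSetoid Γ) c} :=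
        ⟨p.1.1, (p.1.1.primeClass_eq_iff c).2 ⟨p.1.2, p.1.2.2, p.2⟩⟩
      ⟨D, p.1.2 * (transporter D)⁻¹, by
        rw [MulAction.mem_stabilizer_iff, mul_smul, inv_smul_eq_iff.2 (htransporter D).symm]
        exact p.2⟩
    left_inv := fun p => Prod.ext rfl (Subtype.ext (mul_inv_cancel_right _ _))
    right_inv := fun p => Subtype.ext (Prod.ext rfl (inv_mul_cancel_right _ _)) }

theorem card_primeClass_fiber_mul_card_stabilizer (hfree : ActsFreely Γ)
    (hF : IsRepresentatives Γ F) (c : PrimeCycle G) :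
    Nat.card {D : PrimitiveFrom G F // D.primeClass Γ = Quotient.mk (primeSetoid Γ) c} *
      Nat.card (MulAction.stabilizer Γ c.1) = c.1.len := by
  rw [← Nat.card_prod, Nat.card_congr (primeClassFiberProdStabilizerEquiv c),
    Nat.card_congr (translatedFiberEquiv hfree hF c), c.2.card_toCycle_fiber]

end Primitive

/-! ### The Euler product -/

section FiniteFibers

variable {α β E : Type*} [NormedAddCommGroup E]

theorem hasSum_const_of_finite [Finite α] (x : E) : HasSum (fun _ : α => x) (Nat.card α • x) := by
  rw [← tsum_const x]
  exact Summable.of_finite.hasSum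

theorem hasSum_comp_val_of_finite_fiber {p : α → β} {b : β} (hp : Finite {a // p a = b})
    (f : β → E) :
    HasSum (fun a : {a // p a = b} => f (p a.1)) (Nat.card {a // p a = b} • f b) := by
  convert hasSum_const_of_finite (α := {a // p a = b}) (f b) using 3 with a
  exact a.2

theorem hasSum_card_fiber_smul {p : α → β} (hp : ∀ b, Finite {a // p a = b}) {f : β → E} {s : E}
    (hf : HasSum (fun a => f (p a)) s) : HasSum (fun b => Nat.card {a // p a = b} • f b) s := by
  rw [← (Equiv.sigmaFiberEquiv p).hasSum_iff] at hf
  exact hf.sigma fun b => hasSum_comp_val_of_finite_fiber (hp b) f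

theorem hasSum_comp_of_hasSum_card_fiber_smul [NormedSpace ℝ E] [CompleteSpace E] {p : α → β}
    (hp : ∀ b, Finite {a // p a = b}) {f : β → E} {s : E}
    (hf : HasSum (fun b => Nat.card {a // p a = b} • f b) s)
    (hnorm : Summable fun b => ‖Nat.card {a // p a = b} • f b‖) :
    HasSum (fun a => f (p a)) s := by
  rw [← (Equiv.sigmaFiberEquiv p).hasSum_iff]
  refine HasSum.sigma_of_hasSum hf (fun b => hasSum_comp_val_of_finite_fiber (hp b) f)
    (Summable.of_norm ?_)
  have hfiber b := hasSum_comp_val_of_finite_fiber (hp b) fun b => ‖f b‖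
  refine (summable_sigma_of_nonneg fun _ => norm_nonneg _).2 ⟨fun b => (hfiber b).summable, ?_⟩
  refine hnorm.congr fun b => ?_
  rw [RCLike.norm_nsmul ℝ, ← (hfiber b).tsum_eq]
  rfl

end FiniteFibers

section EulerProduct

variable {V : Type*} {G : SimpleGraph V}

theorem hasSum_reducedFrom [G.LocallyFinite] (F : Finset V) {u W : ℂ}
    (hW : HasSum (fun m : ℕ => diagonalSum (dartsFrom G F) (edgeOp G ^ m) * u ^ m / m) W) :
    HasSum (fun C : ReducedFrom G F => u ^ C.1.len / C.1.len) W := by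
  have hcard (m : ℕ) : diagonalSum (dartsFrom G F) (edgeOp G ^ m) * u ^ m / m =
      Nat.card {C : ReducedFrom G F // C.1.len = m} • (u ^ m / m) := by
    rcases m.eq_zero_or_pos with rfl | hm
    · simp only [Nat.cast_zero, div_zero, smul_zero]
    · rw [nsmul_eq_mul, card_reducedFrom_len F hm, mul_div_assoc]
  simp only [hcard] at hW
  exact hasSum_comp_of_hasSum_card_fiber_smul (p := fun C : ReducedFrom G F => C.1.len)
    (f := fun m : ℕ => u ^ m / (m : ℂ)) (finite_reducedFrom_len F) hW hW.summable.norm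

theorem hasSum_pow_succ_mul_div {z : ℂ} {n : ℕ} (hn : n ≠ 0) (hz : ‖z‖ < 1) :
    HasSum (fun k : ℕ => z ^ ((k + 1) * n) / ((k + 1) * n : ℕ)) (-Complex.log (1 - z ^ n) / n) := by
  have hlog := Complex.hasSum_taylorSeries_neg_log (z := z ^ n)
    (by rw [norm_pow]; exact pow_lt_one₀ (norm_nonneg z) hz hn)
  rw [← hasSum_nat_add_iff' 1] at hlog
  simp only [Finset.range_one, Finset.sum_singleton, Nat.cast_zero, div_zero, sub_zero] at hlog
  refine (hlog.div_const (n : ℂ)).congr_fun fun k => ?_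
  rw [mul_comm (k + 1), pow_mul, Nat.cast_mul, mul_comm (n : ℂ), div_div]

theorem hasSum_primitiveFrom (F : Finset V) {u W : ℂ} (hu : ‖u‖ < 1)
    (hW : HasSum (fun C : ReducedFrom G F => u ^ C.1.len / C.1.len) W) :
    HasSum (fun D : PrimitiveFrom G F => -Complex.log (1 - u ^ D.1.len) / D.1.len) W := by
  rw [← (primitiveFromProdEquiv F).hasSum_iff] at hW
  change HasSum (fun p : PrimitiveFrom G F × ℕ =>
    u ^ ((p.2 + 1) * p.1.1.len) / (((p.2 + 1) * p.1.1.len : ℕ) : ℂ)) W at hW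
  refine hW.prod_fiberwise fun D => ?_
  dsimp only
  exact hasSum_pow_succ_mul_div D.1.len_pos.ne' hu

variable {Γ : Subgroup (G ≃g G)}

/-- The representative of a class of prime cycles that `zetaFactor` chooses. -/
def PrimeClass.rep (c : PrimeClass Γ) : PrimeCycle G := Quotient.out c

theorem PrimeClass.mk_rep (c : PrimeClass Γ) : Quotient.mk (primeSetoid Γ) c.rep = c :=
  Quotient.out_eq c

theorem card_primeClass_fiber_mul_card_stabilizer_rep (hfree : ActsFreely Γ) {F : Finset V}
    (hF : IsRepresentatives Γ F) (c : PrimeClass Γ) :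
    Nat.card {D : PrimitiveFrom G F // D.primeClass Γ = c} *
      Nat.card (MulAction.stabilizer Γ c.rep.1) = c.rep.1.len := by
  have hcard := card_primeClass_fiber_mul_card_stabilizer hfree hF c.rep
  rwa [c.mk_rep] at hcard

theorem zetaFactor_eq_exp {u : ℂ} (hu : ‖u‖ < 1) (c : PrimeClass Γ) :
    zetaFactor Γ u c = Complex.exp (Complex.log (1 - u ^ c.rep.1.len) *
      -(1 / (Nat.card (MulAction.stabilizer Γ c.rep.1) : ℂ))) := by
  refine Complex.cpow_def_of_ne_zero (sub_ne_zero.2 fun hone => ?_) _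
  have hlt : ‖u ^ c.rep.1.len‖ < 1 := by
    rw [norm_pow]
    exact pow_lt_one₀ (norm_nonneg u) hu c.rep.1.len_pos.ne'
  exact hlt.ne ((congrArg norm hone).symm.trans norm_one)

theorem hasSum_log_div_card_stabilizer (hfree : ActsFreely Γ) {F : Finset V}
    (hF : IsRepresentatives Γ F) {u W : ℂ}
    (hW : HasSum (fun D : PrimitiveFrom G F => -Complex.log (1 - u ^ D.1.len) / D.1.len) W) :
    HasSum (fun c : PrimeClass Γ => Complex.log (1 - u ^ c.rep.1.len) *
      -(1 / (Nat.card (MulAction.stabilizer Γ c.rep.1) : ℂ))) W := by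
  have hcard := card_primeClass_fiber_mul_card_stabilizer_rep hfree hF
  have hne (c : PrimeClass Γ) := (hcard c).trans_ne c.rep.1.len_pos.ne'
  have hlen (D : PrimitiveFrom G F) : D.1.len = (D.primeClass Γ).rep.1.len :=
    D.len_eq_of_primeClass_eq (D.primeClass Γ).mk_rep.symm
  simp only [hlen] at hW
  refine (hasSum_card_fiber_smul (p := PrimitiveFrom.primeClass Γ)
    (f := fun c => -Complex.log (1 - u ^ c.rep.1.len) / (c.rep.1.len : ℂ))
    (fun c => Nat.finite_of_card_ne_zero (left_ne_zero_of_mul (hne c))) hW).congr_fun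
    fun c => ?_
  have hfiber : (Nat.card {D : PrimitiveFrom G F // D.primeClass Γ = c} : ℂ) ≠ 0 :=
    Nat.cast_ne_zero.2 (left_ne_zero_of_mul (hne c))
  have hstabilizer : (Nat.card (MulAction.stabilizer Γ c.rep.1) : ℂ) ≠ 0 :=
    Nat.cast_ne_zero.2 (right_ne_zero_of_mul (hne c))
  rw [nsmul_eq_mul, congrArg (Nat.cast (R := ℂ)) (hcard c).symm, Nat.cast_mul]
  field_simp

theorem hasProd_zetaFactor (hfree : ActsFreely Γ) {F : Finset V} (hF : IsRepresentatives Γ F)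
    {u W : ℂ} (hu : ‖u‖ < 1)
    (hW : HasSum (fun C : ReducedFrom G F => u ^ C.1.len / C.1.len) W) :
    HasProd (zetaFactor Γ u) (Complex.exp W) := by
  rw [funext (zetaFactor_eq_exp hu)]
  exact (hasSum_log_div_card_stabilizer hfree hF (hasSum_primitiveFrom F hu hW)).cexp

end EulerProduct

section EulerCharacteristic

variable {V : Type*} {G : SimpleGraph V} {Γ : Subgroup (G ≃g G)} {F : Finset V}

theorem card_quotVertex (hF : IsRepresentatives Γ F) : Nat.card (QuotVertex Γ) = F.card := by
  rw [← Nat.card_eq_finsetCard F]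
  refine (Nat.card_eq_of_bijective
    (fun x : F => (Quotient.mk (vertexSetoid Γ) x.1 : QuotVertex Γ)) ⟨fun x y hxy => ?_, ?_⟩).symm
  · obtain ⟨γ, hγ, hγx⟩ := Quotient.exact hxy
    exact Subtype.ext ((hF x.1).unique ⟨x.2, 1, Γ.one_mem, rfl⟩ ⟨y.2, γ, hγ, hγx⟩)
  · rintro ⟨x⟩
    exact ⟨⟨carry hF x x, carry_apply_mem hF x⟩,
      (Quotient.sound ⟨carry hF x, carry_mem hF x, rfl⟩ :
        Quotient.mk (vertexSetoid Γ) x = _).symm⟩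

theorem ActsFreely.smul_ne_symm (hfree : ActsFreely Γ) {γ : G ≃g G} (hγ : γ ∈ Γ) (d : G.Dart) :
    γ • d ≠ d.symm := by
  intro hd
  have hedge : Sym2.map γ d.edge = d.edge := (congrArg SimpleGraph.Dart.edge hd).trans d.edge_symm
  have hone : γ = 1 := by
    by_contra hne
    exact (hfree γ hγ hne).2 d.edge d.edge_mem hedge
  rw [hone, one_smul] at hd
  exact d.symm_ne hd.symm

variable (Γ) in
/-- The edge of the quotient graph below an oriented edge. -/
def quotEdge (d : G.Dart) : QuotEdge Γ := Quotient.mk (edgeSetoid Γ) ⟨d.edge, d.edge_mem⟩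

theorem quotEdge_eq_iff {d e : G.Dart} :
    quotEdge Γ d = quotEdge Γ e ↔ ∃ γ ∈ Γ, γ • d = e ∨ γ • d = e.symm := by
  refine Quotient.eq.trans (exists_congr fun γ => and_congr_right fun _ => ?_)
  exact SimpleGraph.dart_edge_eq_iff (γ • d) e

theorem quotEdge_smul {γ : G ≃g G} (hγ : γ ∈ Γ) (d : G.Dart) :
    quotEdge Γ (γ • d) = quotEdge Γ d :=
  (quotEdge_eq_iff.2 ⟨γ, hγ, Or.inl rfl⟩).symm

theorem quotEdge_symm (d : G.Dart) : quotEdge Γ d.symm = quotEdge Γ d :=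
  quotEdge_eq_iff.2 ⟨1, Γ.one_mem, Or.inr (one_smul _ _)⟩

variable (Γ) in
theorem surjective_quotEdge : Function.Surjective (quotEdge Γ) := by
  rintro ⟨e, he⟩
  induction e with
  | _ x y => exact ⟨⟨(x, y), he⟩, rfl⟩

/-- The translate by `Γ` of an oriented edge that starts in the set `F` of representatives. -/
def dartToRepresentatives (hF : IsRepresentatives Γ F) (d : G.Dart) : G.Dart := carry hF d.fst • d

theorem exists_smul_eq_of_dartToRepresentatives_eq (hF : IsRepresentatives Γ F) {d e : G.Dart}
    (hde : dartToRepresentatives hF d = dartToRepresentatives hF e) : ∃ γ ∈ Γ, γ • d = e :=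
  ⟨(carry hF e.fst)⁻¹ * carry hF d.fst, Γ.mul_mem (Γ.inv_mem (carry_mem hF _)) (carry_mem hF _), by
    rw [mul_smul, inv_smul_eq_iff]
    exact hde⟩

theorem dartToRepresentatives_eq_smul (hfree : ActsFreely Γ) (hF : IsRepresentatives Γ F)
    {γ : G ≃g G} (hγ : γ ∈ Γ) {d : G.Dart} (hd : (γ • d).fst ∈ F) :
    dartToRepresentatives hF d = γ • d := by
  rw [dartToRepresentatives, carry_eq hfree hF hγ hd]

/-- The two oriented edges above the edges of the quotient graph, up to the action of `Γ`; the
boolean is the orientation. -/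
def orientedLift (p : QuotEdge Γ × Bool) : G.Dart :=
  bif p.2 then Function.surjInv (surjective_quotEdge Γ) p.1
  else (Function.surjInv (surjective_quotEdge Γ) p.1).symm

theorem quotEdge_orientedLift (p : QuotEdge Γ × Bool) : quotEdge Γ (orientedLift p) = p.1 := by
  obtain ⟨c, _ | _⟩ := p
  · exact (quotEdge_symm _).trans (Function.surjInv_eq (surjective_quotEdge Γ) c)
  · exact Function.surjInv_eq (surjective_quotEdge Γ) c

theorem orientedLift_not (c : QuotEdge Γ) (b : Bool) :
    orientedLift (c, !b) = (orientedLift (c, b)).symm := by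
  cases b
  · exact (SimpleGraph.Dart.symm_symm _).symm
  · rfl

theorem exists_smul_orientedLift_eq (d : G.Dart) :
    ∃ p : QuotEdge Γ × Bool, ∃ γ ∈ Γ, γ • orientedLift p = d := by
  obtain ⟨γ, hγ, hd | hd⟩ := quotEdge_eq_iff.1 (quotEdge_orientedLift (quotEdge Γ d, true))
  · exact ⟨(quotEdge Γ d, true), γ, hγ, hd⟩
  · refine ⟨(quotEdge Γ d, !true), γ, hγ, ?_⟩
    rw [orientedLift_not, ← symm_smul, hd, SimpleGraph.Dart.symm_symm]

theorem eq_of_smul_orientedLift_eq (hfree : ActsFreely Γ) {γ : G ≃g G} (hγ : γ ∈ Γ)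
    {p p' : QuotEdge Γ × Bool} (hp : γ • orientedLift p = orientedLift p') : p = p' := by
  have hedge : p.1 = p'.1 := by
    rw [← quotEdge_orientedLift p, ← quotEdge_orientedLift p', ← hp, quotEdge_smul hγ]
  obtain ⟨c, b⟩ := p
  obtain ⟨c', b'⟩ := p'
  obtain rfl : c = c' := hedge
  by_contra hne
  obtain rfl : b' = !b := Bool.eq_not.2 fun hb => hne (congrArg (Prod.mk c) hb.symm)
  exact hfree.smul_ne_symm hγ _ (hp.trans (orientedLift_not c b))

variable [G.LocallyFinite]

theorem card_quotEdge_mul_two (hfree : ActsFreely Γ) (hF : IsRepresentatives Γ F) :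
    Nat.card (QuotEdge Γ) * 2 = (dartsFrom G F).card := by
  rw [← Nat.card_eq_finsetCard, ← Fintype.card_bool, ← Nat.card_eq_fintype_card, ← Nat.card_prod]
  refine Nat.card_eq_of_bijective (fun p => ⟨dartToRepresentatives hF (orientedLift p),
    mem_dartsFrom.2 (carry_apply_mem hF _)⟩) ⟨fun p p' hpp' => ?_, fun ⟨d, hd⟩ => ?_⟩
  · obtain ⟨γ, hγ, hp⟩ :=
      exists_smul_eq_of_dartToRepresentatives_eq hF (congrArg Subtype.val hpp')
    exact eq_of_smul_orientedLift_eq hfree hγ hp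
  · obtain ⟨p, γ, hγ, rfl⟩ := exists_smul_orientedLift_eq (Γ := Γ) d
    exact ⟨p, Subtype.ext (dartToRepresentatives_eq_smul hfree hF hγ (mem_dartsFrom.1 hd))⟩

theorem eulerChar_eq (hfree : ActsFreely Γ) (hF : IsRepresentatives Γ F) {q : ℕ}
    (hG : G.IsRegularOfDegree (q + 1)) : (eulerChar Γ : ℂ) = (F.card : ℂ) * (1 - (q : ℂ)) / 2 := by
  have hcard := card_quotEdge_mul_two hfree hF
  rw [card_dartsFrom hG] at hcard
  have hcast : (Nat.card (QuotEdge Γ) : ℂ) * 2 = F.card * (q + 1) := by exact_mod_cast hcard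
  rw [eulerChar, card_quotVertex hF]
  push_cast
  linear_combination (-1 / 2) * hcast

theorem degOp_single_self (d : ℕ) (hd : ∀ v, G.degree v ≤ d) (x : V) [DecidableEq V] :
    degOp G d hd (lp.single 2 x (1 : ℂ)) x = (G.degree x : ℂ) - 1 := by
  change ((G.degree x : ℂ) - 1) * (lp.single 2 x (1 : ℂ) : L2 V) x = _
  rw [lp.single_apply_self, mul_one]

theorem l2EulerChar_eq (F : Finset V) {q : ℕ} (hG : G.IsRegularOfDegree (q + 1)) :
    l2EulerChar G (q + 1) (fun v => (hG v).le) F = (F.card : ℂ) * (1 - (q : ℂ)) / 2 := by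
  classical
  have htrace : trace F (degOp G (q + 1) fun v => (hG v).le) = F.card * q := by
    rw [trace, ← nsmul_eq_mul]
    refine Finset.sum_eq_card_nsmul fun x _ => ?_
    rw [degOp_single_self, hG x, Nat.cast_succ, add_sub_cancel_right]
  rw [l2EulerChar, ← coe_traceCLM, map_sub, traceCLM_one, coe_traceCLM, htrace]
  ring

end EulerCharacteristic

section Zeta

variable {V : Type*} (G : SimpleGraph V) [G.LocallyFinite] {Γ : Subgroup (G ≃g G)}

theorem hasSum_diagonalSum_edgeOp_pow (hfree : ActsFreely Γ) {F : Finset V}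
    (hF : IsRepresentatives Γ F) {q : ℕ} (hG : G.IsRegularOfDegree (q + 1)) {u W : ℂ}
    (hu : ‖u‖ < 1)
    (hW : HasSum (fun m : ℕ =>
      trace F (Polynomial.aeval (regularAdjOp G hG) (Polynomial.dickson 1 (q : ℂ) m)) * u ^ m / m)
      W) :
    HasSum (fun m : ℕ => diagonalSum (dartsFrom G F) (edgeOp G ^ m) * u ^ m / m)
      (W + (eulerChar Γ : ℂ) * (Complex.log (1 - u) + Complex.log (1 + u))) := by
  have hlog := (Complex.hasSum_taylorSeries_neg_log hu).add
    (Complex.hasSum_taylorSeries_neg_log (z := -u) (by rwa [norm_neg]))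
  have hsum := hW.add (hlog.mul_left (F.card * ((q : ℂ) - 1) / 2))
  convert hsum.congr_fun fun m => ?_ using 1
  · rw [eulerChar_eq hfree hF hG, sub_neg_eq_add]
    ring
  · rcases m with _ | m
    · simp only [Nat.cast_zero, div_zero, mul_zero, add_zero]
    · rw [diagonalSum_edgeOp_pow hfree hF hG, neg_pow u]
      ring

theorem hasProd_zetaFactor_determinant (hfree : ActsFreely Γ) {F : Finset V}
    (hF : IsRepresentatives Γ F) {q : ℕ} (hq : 1 ≤ q) (hG : G.IsRegularOfDegree (q + 1)) {u : ℂ}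
    (hu : ‖u‖ < 1 / (q : ℝ)) :
    HasProd (zetaFactor Γ u) ((1 - u ^ 2) ^ eulerChar Γ *
      (analyticDet (trace F) (deformedLaplacian G q hG u))⁻¹) := by
  have hu_one : ‖u‖ < 1 := hu.trans_le ((div_le_one₀ (by positivity)).2 (by exact_mod_cast hq))
  obtain ⟨W, hW, hdet⟩ := exists_hasSum_trace_dickson G hG hq F hu
  convert hasProd_zetaFactor hfree hF hu_one
    (hasSum_reducedFrom F (hasSum_diagonalSum_edgeOp_pow G hfree hF hG hu_one hW)) using 1
  have hsub : 1 - u ≠ 0 := sub_ne_zero.2 fun h => hu_one.ne (by rw [← h, norm_one])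
  have hadd : 1 + u ≠ 0 := fun h =>
    hu_one.ne (by rw [eq_neg_of_add_eq_zero_right h, norm_neg, norm_one])
  rw [Complex.exp_add, Complex.exp_int_mul, Complex.exp_add, Complex.exp_log hsub,
    Complex.exp_log hadd, hdet, Complex.exp_neg, inv_inv, mul_comm]
  congr 2
  ring

end Zeta

end PeriodicGraph

end

theorem mainTheorem5_general {V : Type*} (G : SimpleGraph V) [G.LocallyFinite]
    (q : ℕ) (hq : 1 ≤ q) (hG : G.IsRegularOfDegree (q + 1))
    (Γ : Subgroup (G ≃g G)) (hfree : PeriodicGraph.ActsFreely Γ)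
    (F : Finset V) (hF : PeriodicGraph.IsRepresentatives Γ F) :
    (∀ u : ℂ, PeriodicGraph.deformedLaplacian G q hG u ∈ PeriodicGraph.groupAlg Γ) ∧
    (PeriodicGraph.l2EulerChar G (q + 1) (fun v => (hG v).le) F = (PeriodicGraph.eulerChar Γ : ℂ) ∧
      (PeriodicGraph.eulerChar Γ : ℂ) =
        (Nat.card (PeriodicGraph.QuotVertex Γ) : ℂ) * (1 - (q : ℂ)) / 2) ∧
    (∀ u : ℂ, ‖u‖ < 1 / (q : ℝ) →
      Multipliable (PeriodicGraph.zetaFactor Γ u) ∧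
      PeriodicGraph.zeta Γ u = (1 - u ^ 2) ^ PeriodicGraph.eulerChar Γ *
        (PeriodicGraph.analyticDet (PeriodicGraph.trace F)
          (PeriodicGraph.deformedLaplacian G q hG u))⁻¹) ∧
    (Metric.ball (0 : ℂ) (1 / (q : ℝ)) ⊆ PeriodicGraph.holomorphyDomain q ∧
      IsOpen (PeriodicGraph.holomorphyDomain q) ∧
      (∀ u ∈ PeriodicGraph.holomorphyDomain q,
        (0 : ℂ) ∉ convexHull ℝ (spectrum ℂ (PeriodicGraph.deformedLaplacian G q hG u))) ∧
      DifferentiableOn ℂ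
        (fun u => (1 - u ^ 2) ^ PeriodicGraph.eulerChar Γ *
          (PeriodicGraph.analyticDet (PeriodicGraph.trace F)
            (PeriodicGraph.deformedLaplacian G q hG u))⁻¹)
        (PeriodicGraph.holomorphyDomain q)) ∧
    (∀ u ∈ PeriodicGraph.holomorphyDomain q, u ≠ 0 →
      1 / ((q : ℂ) * u) ∈ PeriodicGraph.holomorphyDomain q ∧
      PeriodicGraph.analyticDet (PeriodicGraph.trace F)
          (PeriodicGraph.deformedLaplacian G q hG (1 / ((q : ℂ) * u))) =
        ((q : ℂ) * u ^ 2) ^ (-(Nat.card (PeriodicGraph.QuotVertex Γ) : ℤ)) *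
          PeriodicGraph.analyticDet (PeriodicGraph.trace F)
            (PeriodicGraph.deformedLaplacian G q hG u)) := by
  have hcard := PeriodicGraph.card_quotVertex hF
  have hχ := PeriodicGraph.eulerChar_eq hfree hF hG
  refine ⟨fun u => PeriodicGraph.deformedLaplacian_mem_groupAlg G hG u Γ, ⟨?_, ?_⟩, fun u hu => ?_,
    ⟨PeriodicGraph.ball_subset_holomorphyDomain hq, PeriodicGraph.isOpen_holomorphyDomain q,
      fun u hu => PeriodicGraph.zero_notMem_convexHull_spectrum G hG hq hu,
      PeriodicGraph.differentiableOn_zeta_extension G hG F hq _⟩, fun u hu hu0 => ⟨?_, ?_⟩⟩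
  · rw [PeriodicGraph.l2EulerChar_eq F hG, hχ]
  · rw [hχ, hcard]
  · have hprod := PeriodicGraph.hasProd_zetaFactor_determinant G hfree hF hq hG hu
    exact ⟨hprod.multipliable, hprod.tprod_eq⟩
  · exact PeriodicGraph.one_div_mem_holomorphyDomain hq hu hu0
  · rw [hcard]
    exact PeriodicGraph.analyticDet_functional_equation G hG F hq hu hu0

theorem mainTheorem5 {V : Type*} [Countable V] (G : SimpleGraph V) [G.LocallyFinite]
    (q : ℕ) (hq : 1 ≤ q) (hG : G.IsRegularOfDegree (q + 1))
    (Γ : Subgroup (G ≃g G)) (hfree : PeriodicGraph.ActsFreely Γ)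
    (F : Finset V) (hF : PeriodicGraph.IsRepresentatives Γ F) :
    -- all `Δ(u)` belong to the von Neumann algebra on which the determinant is considered
    (∀ u : ℂ, PeriodicGraph.deformedLaplacian G q hG u ∈ PeriodicGraph.groupAlg Γ) ∧
    -- (i)
    (PeriodicGraph.l2EulerChar G (q + 1) (fun v => (hG v).le) F = (PeriodicGraph.eulerChar Γ : ℂ) ∧
      (PeriodicGraph.eulerChar Γ : ℂ) =
        (Nat.card (PeriodicGraph.QuotVertex Γ) : ℂ) * (1 - (q : ℂ)) / 2) ∧
    -- (ii)
    (∀ u : ℂ, ‖u‖ < 1 / (q : ℝ) →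
      Multipliable (PeriodicGraph.zetaFactor Γ u) ∧
      PeriodicGraph.zeta Γ u = (1 - u ^ 2) ^ PeriodicGraph.eulerChar Γ *
        (PeriodicGraph.analyticDet (PeriodicGraph.trace F)
          (PeriodicGraph.deformedLaplacian G q hG u))⁻¹) ∧
    -- (iii)
    (Metric.ball (0 : ℂ) (1 / (q : ℝ)) ⊆ PeriodicGraph.holomorphyDomain q ∧
      IsOpen (PeriodicGraph.holomorphyDomain q) ∧
      (∀ u ∈ PeriodicGraph.holomorphyDomain q,
        (0 : ℂ) ∉ convexHull ℝ (spectrum ℂ (PeriodicGraph.deformedLaplacian G q hG u))) ∧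
      DifferentiableOn ℂ
        (fun u => (1 - u ^ 2) ^ PeriodicGraph.eulerChar Γ *
          (PeriodicGraph.analyticDet (PeriodicGraph.trace F)
            (PeriodicGraph.deformedLaplacian G q hG u))⁻¹)
        (PeriodicGraph.holomorphyDomain q)) ∧
    -- (iv)
    (∀ u ∈ PeriodicGraph.holomorphyDomain q, u ≠ 0 →
      1 / ((q : ℂ) * u) ∈ PeriodicGraph.holomorphyDomain q ∧
      PeriodicGraph.analyticDet (PeriodicGraph.trace F)
          (PeriodicGraph.deformedLaplacian G q hG (1 / ((q : ℂ) * u))) =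
        ((q : ℂ) * u ^ 2) ^ (-(Nat.card (PeriodicGraph.QuotVertex Γ) : ℤ)) *
          PeriodicGraph.analyticDet (PeriodicGraph.trace F)
            (PeriodicGraph.deformedLaplacian G q hG u)) :=
  mainTheorem5_general G q hq hG Γ hfree F hF
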